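/- Consider the scalar plant $x_{k+1}=a x_k+b u_k+w_k$, $k\ge 0$, with $b\neq 0$, where $w_0,w_1,\dots$ are i.i.d. $\mathcal N(0,\sigma_w^2)$ with $\sigma_w>0$, and $x_0\sim\mathcal N(0,\sigma_0^2)$. Let $K=-a/b$ (dead-beat gain), let $\varepsilon>0$ be the event threshold, $\mathrm T\in\{0,1,2,\dots\}$ the time-out, and $p_\ell\in(0,1)$ the packet-loss probability. Let $Q_x\ge 0$, $Q_u>0$ and $\rho\in\mathbb R$. Let $r_k$ be the age counter and $\gamma_k$ the number of consecutive transmission failures immediately before time $k$. If $(r_k,\gamma_k)=(0,0)$, a control packet is received at time $k$ and $u_k=Kx_k$; otherwise $u_k=0$. A transmission is attempted at time $k+1$ if $|x_{k+1}|>\varepsilon$, or $r_k+1>\mathrm T$, or $\gamma_k\ne 0$. An attempt at time $k+1$ is lost with probability $p_\ell$, and then $(r_{k+1},\gamma_{k+1})=(r_k,\gamma_k+1)$; otherwise it succeeds and $(r_{k+1},\gamma_{k+1})=(0,0)$. If there is no attempt, $(r_{k+1},\gamma_{k+1})=(r_k+1,0)$. The losses are i.i.d., and the noise, the losses and the ($\mathbb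 R\times\mathbb N_0\times\mathbb N_0$-valued, otherwise arbitrary) initial condition $(x_0,r_0,\gamma_0)$ are mutually independent. For $i\ge 0$ put $\xi_i=\sum_{j=0}^{i}a^{j}w_{i-j}$ and $\mathcal F_i=\bigcap_{j=0}^{i-1}\{|\xi_j|\le\varepsilon\}$ ($\mathcal F_0$ is the sure event). Put $p_{i0}=\mathbf P(|\xi_i|>\varepsilon\mid\mathcal F_i)$ for $0\le i<\mathrm T$ and $p_{\mathrm T0}=1$. Further, let $$\Sigma_i=\mathbf{Var}[\xi_i\mid\mathcal F_{i+1}],\qquad \Sigma_i^c=\mathbf{Var}[\xi_i\mid|\xi_i|>\varepsilon,\mathcal F_i]\qquad(0\le i\le\mathrm T-1),$$ $$\Sigma_{\mathrm T}^c=a^2\,\mathbf{Var}[\xi_{\mathrm T-1}\mid\mathcal F_{\mathrm T}]+\sigma_w^2\quad(\text{with }\xi_{-1}=0\text{ if }\mathrm T=0),\qquad \widehat Q=\frac{(1-p_\ell)(Q_x+\rho K^2Q_u)+p_\ell Q_x}{1-p_\ell a^2}.$$ The chain $(r,\gamma)$ on $\{0,\dots,\mathrm T\}\times\mathbb N_0$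 has the following transition probabilities. From $(i,0)$ it moves to $(0,0)$ with probability $(1-p_\ell)p_{i0}$, to $(i,1)$ with probability $p_\ell p_{i0}$, and to $(i+1,0)$ with probability $1-p_{i0}$. From $(i,j)$ with $j\ge1$ it moves to $(0,0)$ with probability $1-p_\ell$ and to $(i,j+1)$ with probability $p_\ell$. Suppose that $p_\ell a^2<1$. Then this chain has a unique invariant probability distribution $\pi$, and its value $\pi_{00}$ at $(0,0)$ is $$\pi_{00}=\frac1{\Theta_0+\sum_{n=1}^{\mathrm T}\Theta_n\prod_{m=0}^{n-1}(1-p_{m0})},\qquad \Theta_i=\frac{1-p_\ell(1-p_{i0})}{1-p_\ell}.$$ Almost surely, the fraction of the times $k\in\{0,\dots,N-1\}$ at which a control packet is received, i.e. $(r_k,\gamma_k)=(0,0)$, converges to $\pi_{00}$ as $N\to\infty$. Moreover, almost surely, the limit $J_\infty=\lim_{N\to\infty}\frac1N\sum_{k=0}^{N-1}\left(Q_xx_k^2+\rho Q_uu_k^2\right)$ exists and $$J_\infty=\Bigg[p_{00}\widehat Q\Big(\Sigma_0^c+\frac{p_\ell\sigma_w^2}{1-p_\ell}\Big)+\sum_{i=1}^{\mathrm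 T}\Big[Q_x\Sigma_{i-1}+p_{i0}\widehat Q\Big(\Sigma_i^c+\frac{p_\ell\sigma_w^2}{1-p_\ell}\Big)\Big]\prod_{j=0}^{i-1}(1-p_{j0})\Bigg]\pi_{00}.$$ -/

import Mathlib

open MeasureTheory ProbabilityTheory Filter Topology

namespace ErasureLoop

/-! ### The closed loop -/

/-- The state `(x, r, γ)` of the closed loop: the plant state `x`, the counter `r`, and the number
`γ` of consecutive failed transmissions up to now. A control packet is received by the actuator at
exactly the times at which `(r, γ) = (0, 0)`. -/
abbrev LoopState : Type := ℝ × ℕ × ℕ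

/-- The input applied by the actuator: `K x` when a packet has just been received, and `0`
otherwise. -/
noncomputable def input (K : ℝ) (s : LoopState) : ℝ :=
  if s.2 = (0, 0) then K * s.1 else 0

/-- The plant `x⁺ = a x + b u + w`. -/
noncomputable def plant (a b K : ℝ) (s : LoopState) (w : ℝ) : ℝ :=
  a * s.1 + b * input K s + w

/-- The update of `(r, γ)` when the new plant state is `x'`. A transmission is attempted when
`|x'| > ε`, when more than `T` samples have passed, i.e. `r + 1 > T`, or when the preceding attempt
failed. If the attempt succeeds the pair is reset to `(0, 0)`; if it is lost then `r` is kept and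
`γ` increases; without an attempt `r` increases. -/
noncomputable def schedule (ε : ℝ) (T : ℕ) (r γ : ℕ) (x' : ℝ) (lost : Bool) : ℕ × ℕ :=
  if ε < |x'| ∨ T < r + 1 ∨ γ ≠ 0 then
    if lost = true then (r, γ + 1) else (0, 0)
  else (r + 1, 0)

/-- One step of the closed loop, with process noise `w` and channel outcome `lost`. -/
noncomputable def step (a b K ε : ℝ) (T : ℕ) (s : LoopState) (w : ℝ) (lost : Bool) : LoopState :=
  (plant a b K s w, schedule ε T s.2.1 s.2.2 (plant a b K s w) lost)

/-- The trajectory of the closed loop; the noise `w k` acts between the times `k` and `k + 1`, and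
`lost k` is the channel outcome of a transmission attempted at time `k`. -/
noncomputable def trajectory (a b K ε : ℝ) (T : ℕ) (s₀ : LoopState) (w : ℕ → ℝ)
    (lost : ℕ → Bool) : ℕ → LoopState
  | 0 => s₀
  | k + 1 => step a b K ε T (trajectory a b K ε T s₀ w lost k) (w k) (lost (k + 1))

/-- The stage cost `Q_x x² + ρ Q_u u²`. -/
noncomputable def stageCost (Qx Qu ρ K : ℝ) (s : LoopState) : ℝ :=
  Qx * s.1 ^ 2 + ρ * (Qu * input K s ^ 2)

/-! ### The quantities in the formula -/

section Quantities

variable {Ω : Type*} [MeasurableSpace Ω]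

/-- `ξ_i = ∑_{j = 0}^{i} a^j w_{i - j}`: the plant state `i + 1` steps after a reset at time `0`
if there is no further input. -/
noncomputable def xi (a : ℝ) (w : ℕ → Ω → ℝ) (i : ℕ) (ω : Ω) : ℝ :=
  ∑ j ∈ Finset.range (i + 1), a ^ j * w (i - j) ω

/-- The event `𝓕_i = {|ξ_j| ≤ ε for all 0 ≤ j ≤ i - 1}`; `𝓕_0` is the sure event. -/
def quiet (a ε : ℝ) (w : ℕ → Ω → ℝ) (i : ℕ) : Set Ω :=
  {ω | ∀ j < i, |xi a w j ω| ≤ ε}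

/-- The event `{|ξ_i| > ε}`. -/
def crossing (a ε : ℝ) (w : ℕ → Ω → ℝ) (i : ℕ) : Set Ω :=
  {ω | ε < |xi a w i ω|}

/-- `p_{i0}`: it is `P(|ξ_i| > ε ∣ 𝓕_i)` for `i < T`, and `1` for `i = T`. -/
noncomputable def pZero (P : Measure Ω) (a ε : ℝ) (T : ℕ) (w : ℕ → Ω → ℝ) (i : ℕ) : ℝ :=
  if i < T then (cond P (quiet a ε w i)).real (crossing a ε w i) else 1

/-- `Σ_i = Var[ξ_i ∣ 𝓕_{i+1}]`. -/
noncomputable def varQuiet (P : Measure Ω) (a ε : ℝ) (w : ℕ → Ω → ℝ) (i : ℕ) : ℝ :=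
  variance (xi a w i) (cond P (quiet a ε w (i + 1)))

/-- `a² Var[ξ_{T-1} ∣ 𝓕_T] + σ²`, where `ξ_{-1} = 0` is the empty sum. -/
noncomputable def varTimeout (P : Measure Ω) (a ε σ : ℝ) (w : ℕ → Ω → ℝ) : ℕ → ℝ
  | 0 => σ ^ 2
  | t + 1 => a ^ 2 * variance (xi a w t) (cond P (quiet a ε w (t + 1))) + σ ^ 2

/-- `Σ_i^c`: it is `Var[ξ_i ∣ |ξ_i| > ε, 𝓕_i]` for `i < T`, and
`a² Var[ξ_{T-1} ∣ 𝓕_T] + σ²` for `i = T`. -/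
noncomputable def varCross (P : Measure Ω) (a ε σ : ℝ) (T : ℕ) (w : ℕ → Ω → ℝ) (i : ℕ) : ℝ :=
  if i < T then variance (xi a w i) (cond P (crossing a ε w i ∩ quiet a ε w i))
  else varTimeout P a ε σ w T

end Quantities

/-- `Q̂`. -/
noncomputable def Qhat (a K Qx Qu ρ p : ℝ) : ℝ :=
  ((1 - p) * (Qx + ρ * (K * Qu * K)) + p * Qx) / (1 - p * a ^ 2)

/-- `Θ_i = (1 - p (1 - p_{i0})) / (1 - p)`, where `q i` stands for `p_{i0}`. -/
noncomputable def Theta (p : ℝ) (q : ℕ → ℝ) (i : ℕ) : ℝ :=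
  (1 - p * (1 - q i)) / (1 - p)

/-! ### The Markov chain `(r, γ)` -/

/-- The probability that a transmission is attempted in the next step from the state `(i, j)`. -/
noncomputable def attemptProb (q : ℕ → ℝ) (i j : ℕ) : ℝ := if j = 0 then q i else 1

/-- The transition probabilities of the chain `(r, γ)` on `{0, …, T} × ℕ`: from `(i, j)` it goes
to `(0, 0)` if there is a successful attempt, to `(i, j + 1)` if there is a failed attempt, and
to `(i + 1, 0)` if there is none. -/
noncomputable def transition (p : ℝ) (q : ℕ → ℝ) (T : ℕ) (s s' : Fin (T + 1) × ℕ) : ℝ :=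
  (if s' = (0, 0) then (1 - p) * attemptProb q s.1 s.2 else 0)
    + (if s' = (s.1, s.2 + 1) then p * attemptProb q s.1 s.2 else 0)
    + (if (s'.1 : ℕ) = (s.1 : ℕ) + 1 ∧ s'.2 = 0 then 1 - attemptProb q s.1 s.2 else 0)

/-- `π` is an invariant probability distribution of the transition matrix `M`. -/
def IsInvariantDistribution {S : Type*} (M : S → S → ℝ) (π : S → ℝ) : Prop :=
  (∀ s, 0 ≤ π s) ∧ HasSum π 1 ∧ ∀ s', HasSum (fun s => π s * M s s') (π s')

end ErasureLoop

/-! Since `a + b * K = 0`, a received packet cancels the plant state: one step later the state is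
the noise alone. Receptions are therefore regeneration times, after which the loop is a copy of the
loop started in the zero state and driven by fresh noise and fresh channel outcomes. By the strong
Markov property of i.i.d. sequences (`seqLaw_inter_shiftAt`) the costs of the successive cycles are
pairwise independent with a common law. The strong law, with monotone interpolation between the ends
of cycles, gives the renewal-reward theorem `tendsto_average_of_renewal`: the time average of a
nonnegative cost tends to mean cost per cycle over mean cycle length. As a first reception occurs
almost surely, `ae_tendsto_average_loop` extends this to every initial state.

A cycle has a simple shape (`alive_iff`): the undriven state `drift`, which is `ξ`, evolves quietly
until a first attempt at a time `i + 1` with `i ≤ T`; then an attempt is made at every step until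
one succeeds, after `m` losses. The noise decides `i` and the channel decides `m`, so a mean cost is
a double series with weights `p ^ m` (`tsum_lintegral_alive`). On the event `D` of a first attempt
at `i + 1`, the second moments `v m` of the state satisfy `v (m + 1) = a ^ 2 * v m + σ ^ 2 * P D`.
As `p * a ^ 2 < 1`, the series `∑ p ^ m * v m` converges (`hasSum_geometric_affine`); its sum
produces the denominator of `Qhat` and the terms `p * σ ^ 2 / (1 - p)`. The quiet and attempt events
are invariant under a sign change of the noise, whose law is symmetric; so conditional means vanish
and conditional variances are normalized second moments.

In the chain `(r, γ)` every state except `(0, 0)` can be entered from one state only, so the value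
at `(0, 0)` determines an invariant vector. With that value `1` the total mass is `chainTotal`,
which is also the mean cycle length. Hence `π (0, 0)` is the frequency of receptions and the factor
in the cost. -/

namespace ErasureLoop

/-! ### Sequences of independent, identically distributed variables -/

section Sequences

variable {E : Type*}

/-- The sequence without its first `n` terms. -/
def shiftSeq (n : ℕ) (z : ℕ → E) : ℕ → E := fun k => z (n + k)

/-- The sequence with its terms from the index `n` on replaced by `e`. -/
def truncSeq (e : E) (n : ℕ) (z : ℕ → E) : ℕ → E := fun k => if k < n then z k else e

lemma truncSeq_of_lt (e : E) {n k : ℕ} (z : ℕ → E) (h : k < n) : truncSeq e n z k = z k :=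
  if_pos h

variable [MeasurableSpace E]

@[fun_prop]
lemma measurable_shiftSeq (n : ℕ) : Measurable (shiftSeq n : (ℕ → E) → ℕ → E) :=
  measurable_pi_iff.2 fun _ => measurable_pi_apply _

/-- The two sides are functions of the disjoint blocks of coordinates below `n` and from `n` on.
Padding with `e` keeps the past in the space of full sequences. -/
lemma indepFun_truncSeq_shiftSeq {Ω : Type*} [MeasurableSpace Ω] {P : Measure Ω}
    {Z : ℕ → Ω → E} (hZ : ∀ k, Measurable (Z k)) (hi : iIndepFun Z P) (e : E) (n : ℕ) :
    IndepFun (fun ω => truncSeq e n fun k => Z k ω) (fun ω => shiftSeq n fun k => Z k ω) P := by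
  have h := indep_iSup_of_disjoint (fun i => (hZ i).comap_le)
    ((iIndepFun_iff_iIndep _ _ _).1 hi) (S := Set.Iio n) (T := Set.Ici n)
    (Set.disjoint_left.2 fun k h1 h2 => absurd (Set.mem_Iio.1 h1) (not_lt.2 h2))
  rw [IndepFun_iff_Indep]
  refine indep_of_indep_of_le_left (indep_of_indep_of_le_right h ?_) ?_
  · rw [← measurable_iff_comap_le]
    refine @measurable_pi_lambda _ _ _ (_) _ _ fun k => ?_
    refine Measurable.mono (comap_measurable (Z (n + k))) ?_ le_rfl
    exact le_iSup₂_of_le (n + k) (Set.mem_Ici.2 (Nat.le_add_right n k)) le_rfl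
  · rw [← measurable_iff_comap_le]
    refine @measurable_pi_lambda _ _ _ (_) _ _ fun k => ?_
    by_cases hk : k < n
    · simp only [truncSeq, if_pos hk]
      refine Measurable.mono (comap_measurable (Z k)) ?_ le_rfl
      exact le_iSup₂_of_le k (Set.mem_Iio.2 hk) le_rfl
    · simp only [truncSeq, if_neg hk]
      exact measurable_const

/-- The law of a sequence of independent variables of law `ν`. -/
noncomputable abbrev seqLaw (ν : Measure E) [IsProbabilityMeasure ν] : Measure (ℕ → E) :=
  Measure.infinitePi fun _ => ν

variable {ν : Measure E} [IsProbabilityMeasure ν]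

lemma map_seq_eq_seqLaw {Ω : Type*} [MeasurableSpace Ω] {P : Measure Ω}
    {Z : ℕ → Ω → E} (hZ : ∀ k, Measurable (Z k)) (hi : iIndepFun Z P)
    (hl : ∀ k, P.map (Z k) = ν) : P.map (fun ω k => Z k ω) = seqLaw ν := by
  have := hi.map_fun_eq_infinitePi_map hZ
  simp only [this, hl]

lemma map_shiftSeq_eq_seqLaw {Ω : Type*} [MeasurableSpace Ω] {P : Measure Ω}
    {Z : ℕ → Ω → E} (hZ : ∀ k, Measurable (Z k)) (hi : iIndepFun Z P)
    (hl : ∀ k, P.map (Z k) = ν) (n : ℕ) :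
    P.map (fun ω => shiftSeq n fun k => Z k ω) = seqLaw ν :=
  map_seq_eq_seqLaw (Z := fun k => Z (n + k)) (fun _ => hZ _)
    (hi.precomp (add_right_injective n)) fun _ => hl _

lemma iIndepFun_seqLaw (ν : Measure E) [IsProbabilityMeasure ν] :
    iIndepFun (fun k (z : ℕ → E) => z k) (seqLaw ν) :=
  iIndepFun_infinitePi (P := fun _ : ℕ => ν) (X := fun _ x => x) fun _ => measurable_id

/-- The hypothesis `hdep` expresses that `A` depends on the first `n` coordinates only. -/
lemma seqLaw_inter_trunc_shift (e : E) (n : ℕ) {A B : Set (ℕ → E)}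
    (hA : MeasurableSet A) (hB : MeasurableSet B)
    (hdep : ∀ z, z ∈ A ↔ truncSeq e n z ∈ A) :
    seqLaw ν (A ∩ shiftSeq n ⁻¹' B) = seqLaw ν A * seqLaw ν B := by
  have h := indepFun_truncSeq_shiftSeq (fun k => measurable_pi_apply k) (iIndepFun_seqLaw ν) e n
  have h2 := h.measure_inter_preimage_eq_mul A B hA hB
  have h3 := map_shiftSeq_eq_seqLaw (ν := ν) (fun k => measurable_pi_apply k)
    (iIndepFun_seqLaw ν) (fun k => Measure.infinitePi_map_eval _ k) n
  have hA' : (fun ω : ℕ → E => truncSeq e n fun k => ω k) ⁻¹' A = A :=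
    Set.ext fun z => (hdep z).symm
  rw [hA'] at h2
  rw [← h3, Measure.map_apply (measurable_shiftSeq n) hB, h3]
  exact h2

/-! ### Regeneration at a stopping time -/

/-- The sequence from the random time `τ` on. -/
def shiftAt (τ : (ℕ → E) → ℕ) (z : ℕ → E) : ℕ → E := shiftSeq (τ z) z

lemma measurable_shiftAt {τ : (ℕ → E) → ℕ} (hτ : Measurable τ) : Measurable (shiftAt τ) := by
  have : Measurable fun q : ℕ × (ℕ → E) => shiftSeq q.1 q.2 :=
    measurable_from_prod_countable_right fun n => measurable_shiftSeq n
  exact this.comp (hτ.prodMk measurable_id)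

/-- Strong Markov property, by splitting along the values of `τ`: on `τ = n` both `τ` and `f` depend
on the first `n` terms only, by `hcausal`. The value `0` stands for "never" and has probability
zero. -/
lemma seqLaw_inter_shiftAt {F : Type*} [MeasurableSpace F] {τ : (ℕ → E) → ℕ} (hτ : Measurable τ)
    (hpos : ∀ᵐ z ∂seqLaw ν, 0 < τ z) {f : (ℕ → E) → F} (hf : Measurable f)
    (hcausal : ∀ z z' : ℕ → E, 0 < τ z → (∀ k < τ z, z k = z' k) → τ z' = τ z ∧ f z' = f z)
    {A : Set F} {B : Set (ℕ → E)} (hA : MeasurableSet A) (hB : MeasurableSet B) :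
    seqLaw ν (f ⁻¹' A ∩ shiftAt τ ⁻¹' B) = seqLaw ν (f ⁻¹' A) * seqLaw ν B := by
  have key : ∀ n, seqLaw ν (f ⁻¹' A ∩ shiftAt τ ⁻¹' B ∩ τ ⁻¹' {n})
      = seqLaw ν (f ⁻¹' A ∩ τ ⁻¹' {n}) * seqLaw ν B := by
    intro n
    have hn := hτ (measurableSet_singleton n)
    rcases Nat.eq_zero_or_pos n with rfl | h0
    · have h0 : seqLaw ν (τ ⁻¹' {0}) = 0 := by
        refine measure_mono_null (fun z hz => ?_) hpos
        simpa using hz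
      rw [measure_mono_null Set.inter_subset_right h0,
        measure_mono_null Set.inter_subset_right h0, zero_mul]
    · obtain ⟨e⟩ : Nonempty E := nonempty_of_isProbabilityMeasure ν
      rw [← seqLaw_inter_trunc_shift e n ((hf hA).inter hn) hB]
      · congr 1
        ext z
        simp only [Set.mem_inter_iff, Set.mem_preimage, Set.mem_singleton_iff, shiftAt]
        constructor
        · rintro ⟨⟨h1, h2⟩, rfl⟩
          exact ⟨⟨h1, rfl⟩, h2⟩
        · rintro ⟨⟨h1, rfl⟩, h2⟩
          exact ⟨⟨h1, h2⟩, rfl⟩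
      · intro z
        simp only [Set.mem_inter_iff, Set.mem_preimage, Set.mem_singleton_iff]
        constructor
        · rintro ⟨h1, rfl⟩
          obtain ⟨h3, h4⟩ := hcausal z (truncSeq e (τ z) z) h0
            fun k hk => (truncSeq_of_lt e z hk).symm
          exact ⟨h4 ▸ h1, h3⟩
        · rintro ⟨h1, h2⟩
          obtain ⟨h3, h4⟩ := hcausal (truncSeq e n z) z (by rwa [h2])
            fun k hk => truncSeq_of_lt e z (by rwa [h2] at hk)
          exact ⟨h4 ▸ h1, h3.trans h2⟩
  have hS := measurable_shiftAt hτ hB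
  have hsum : ∀ s : Set (ℕ → E), MeasurableSet s →
      seqLaw ν s = ∑' n, seqLaw ν (s ∩ τ ⁻¹' {n}) := by
    intro s hs
    rw [← measure_iUnion]
    · congr 1
      ext z
      simp
    · intro m n hmn
      refine Set.disjoint_left.2 fun z h1 h2 => hmn ?_
      exact (Set.mem_singleton_iff.1 h1.2).symm.trans (Set.mem_singleton_iff.1 h2.2)
    · exact fun n => hs.inter (hτ (measurableSet_singleton n))
  rw [hsum _ ((hf hA).inter hS), hsum _ (hf hA), ← ENNReal.tsum_mul_right]
  exact tsum_congr key

lemma measurePreserving_shiftAt {τ : (ℕ → E) → ℕ} (hτ : Measurable τ)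
    (hpos : ∀ᵐ z ∂seqLaw ν, 0 < τ z)
    (hcausal : ∀ z z' : ℕ → E, 0 < τ z → (∀ k < τ z, z k = z' k) → τ z' = τ z) :
    MeasurePreserving (shiftAt τ) (seqLaw ν) (seqLaw ν) := by
  refine ⟨measurable_shiftAt hτ, Measure.ext fun B hB => ?_⟩
  rw [Measure.map_apply (measurable_shiftAt hτ) hB]
  have := seqLaw_inter_shiftAt hτ hpos hτ (fun z z' h1 h2 => ⟨hcausal z z' h1 h2, hcausal z z' h1 h2⟩)
    MeasurableSet.univ hB
  simpa using this

lemma indepFun_shiftAt {F : Type*} [MeasurableSpace F] {τ : (ℕ → E) → ℕ} (hτ : Measurable τ)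
    (hpos : ∀ᵐ z ∂seqLaw ν, 0 < τ z) {f : (ℕ → E) → F} (hf : Measurable f)
    (hcausal : ∀ z z' : ℕ → E, 0 < τ z → (∀ k < τ z, z k = z' k) → τ z' = τ z ∧ f z' = f z) :
    IndepFun f (shiftAt τ) (seqLaw ν) := by
  refine indepFun_iff_measure_inter_preimage_eq_mul.2 fun A B hA hB => ?_
  rw [seqLaw_inter_shiftAt hτ hpos hf hcausal hA hB, (measurePreserving_shiftAt hτ hpos
    fun z z' h1 h2 => (hcausal z z' h1 h2).1).measure_preimage hB.nullMeasurableSet]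

/-- The strong law of large numbers along the successive cycles. -/
lemma tendsto_average_cycles {τ : (ℕ → E) → ℕ} (hτ : Measurable τ)
    (hpos : ∀ᵐ z ∂seqLaw ν, 0 < τ z) {f : (ℕ → E) → ℝ} (hf : Measurable f)
    (hcausal : ∀ z z' : ℕ → E, 0 < τ z → (∀ k < τ z, z k = z' k) → τ z' = τ z ∧ f z' = f z)
    (hint : Integrable f (seqLaw ν)) :
    ∀ᵐ z ∂seqLaw ν, Tendsto (fun n : ℕ => (∑ i ∈ Finset.range n, f ((shiftAt τ)^[i] z)) / n)
      atTop (𝓝 (∫ z, f z ∂seqLaw ν)) := by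
  have hS := measurePreserving_shiftAt hτ hpos fun z z' h1 h2 => (hcausal z z' h1 h2).1
  have hSi : ∀ i, MeasurePreserving (shiftAt τ)^[i] (seqLaw ν) (seqLaw ν) := hS.iterate
  have hlt : ∀ i j, i < j →
      IndepFun (fun z => f ((shiftAt τ)^[i] z)) (fun z => f ((shiftAt τ)^[j] z)) (seqLaw ν) := by
    intro i j hij
    -- With `S = shiftAt τ` and `j = i + m + 1`, the pair is `(f, f ∘ S^[m] ∘ S)` composed with the
    -- measure-preserving map `S^[i]`, so independence of `f` and `S` suffices.
    obtain ⟨m, rfl⟩ := Nat.exists_eq_add_of_lt hij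
    refine indepFun_iff_measure_inter_preimage_eq_mul.2 fun A B hA hB => ?_
    have h := (indepFun_shiftAt hτ hpos hf hcausal).measure_inter_preimage_eq_mul A
      ((shiftAt τ)^[m] ⁻¹' (f ⁻¹' B)) hA ((hSi m).measurable (hf hB))
    have e1 : (fun z => f ((shiftAt τ)^[i] z)) ⁻¹' A = (shiftAt τ)^[i] ⁻¹' (f ⁻¹' A) := rfl
    have e2 : (fun z => f ((shiftAt τ)^[i + m + 1] z)) ⁻¹' B
        = (shiftAt τ)^[i] ⁻¹' (shiftAt τ ⁻¹' ((shiftAt τ)^[m] ⁻¹' (f ⁻¹' B))) := by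
      ext z
      simp only [Set.mem_preimage]
      rw [← Function.iterate_succ_apply, ← Function.iterate_add_apply, add_comm i m,
        Nat.add_right_comm]
    have mA := hf hA
    have mB := hS.measurable ((hSi m).measurable (hf hB))
    rw [e1, e2, ← Set.preimage_inter, (hSi i).measure_preimage (mA.inter mB).nullMeasurableSet,
      (hSi i).measure_preimage mA.nullMeasurableSet,
      (hSi i).measure_preimage mB.nullMeasurableSet, h]
  refine strong_law_ae_real (fun i z => f ((shiftAt τ)^[i] z)) hint ?_ ?_
  · intro i j hij
    rcases lt_or_gt_of_ne hij with h | h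
    · exact hlt i j h
    · exact (hlt j i h).symm
  · intro i
    refine ⟨(hf.comp (hSi i).measurable).aemeasurable, hf.aemeasurable, ?_⟩
    have : (fun z => f ((shiftAt τ)^[i] z)) = f ∘ (shiftAt τ)^[i] := rfl
    simp only [this]
    rw [← Measure.map_map hf (hSi i).measurable, (hSi i).map_eq]
    rfl

/-- If a nondecreasing sequence grows linearly along an unbounded sequence of indices that itself
grows linearly, then it grows linearly. -/
lemma tendsto_div_of_tendsto_along {A : ℕ → ℝ} (hA : Monotone A) {c : ℕ → ℕ} {t r : ℝ}
    (ht : 0 < t) (hc : Tendsto (fun n : ℕ => (c n : ℝ) / n) atTop (𝓝 t))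
    (hr : Tendsto (fun n : ℕ => A (c n) / n) atTop (𝓝 r)) :
    Tendsto (fun N : ℕ => A N / N) atTop (𝓝 (r / t)) := by
  -- One sequence `c` serves for every ratio `q > 1`: linear growth forces `c (n + 1) ≤ q * c n`
  -- eventually.
  refine tendsto_div_of_monotone_of_exists_subseq_tendsto_div A _ hA fun q hq => ⟨c, ?_, ?_, ?_⟩
  · have h1 : Tendsto (fun n : ℕ => ((n + 1 : ℕ) : ℝ) / n) atTop (𝓝 1) := by
      have h : Tendsto (fun n : ℕ => 1 + 1 / (n : ℝ)) atTop (𝓝 (1 + 0)) :=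
        tendsto_const_nhds.add tendsto_one_div_atTop_nhds_zero_nat
      rw [add_zero] at h
      refine h.congr' ?_
      filter_upwards [eventually_gt_atTop 0] with n hn
      have : (n : ℝ) ≠ 0 := by positivity
      push_cast
      field_simp
    have h2 := (((tendsto_add_atTop_iff_nat 1).2 hc).mul h1).sub (hc.const_mul q)
    have h3 : t * 1 - q * t < 0 := by nlinarith
    filter_upwards [h2.eventually_lt_const h3, eventually_gt_atTop 0] with n hn hn0
    have hn0' : (0 : ℝ) < n := by positivity
    have e : (c (n + 1) : ℝ) / ((n + 1 : ℕ) : ℝ) * (((n + 1 : ℕ) : ℝ) / n) - q * (c n / n)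
        = (c (n + 1) - q * c n) / n := by
      have : ((n + 1 : ℕ) : ℝ) ≠ 0 := by positivity
      field_simp
    rw [e, div_lt_iff₀ hn0'] at hn
    linarith
  · have h := hc.pos_mul_atTop ht (tendsto_natCast_atTop_atTop (R := ℝ))
    rw [← tendsto_natCast_atTop_iff (R := ℝ)]
    refine h.congr' ?_
    filter_upwards [eventually_gt_atTop 0] with n hn
    have : (n : ℝ) ≠ 0 := by positivity
    field_simp
  · refine (hr.div hc ht.ne').congr' ?_
    filter_upwards [eventually_gt_atTop 0] with n hn
    have : (n : ℝ) ≠ 0 := by positivity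
    simp only [Pi.div_apply]
    field_simp

/-- The renewal-reward theorem for a nonnegative reward process that starts anew after each
cycle of length `τ`. -/
theorem tendsto_average_of_renewal {τ : (ℕ → E) → ℕ} (hτ : Measurable τ)
    (hpos : ∀ᵐ z ∂seqLaw ν, 0 < τ z) {C : (ℕ → E) → ℕ → ℝ} (hC0 : ∀ z k, 0 ≤ C z k)
    (hRm : Measurable fun z => ∑ k ∈ Finset.range (τ z), C z k)
    (hcausal : ∀ z z' : ℕ → E, 0 < τ z → (∀ k < τ z, z k = z' k) →
      τ z' = τ z ∧ ∀ k < τ z, C z' k = C z k)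
    (hreg : ∀ z, 0 < τ z → ∀ k, C z (τ z + k) = C (shiftAt τ z) k)
    (hτi : Integrable (fun z => (τ z : ℝ)) (seqLaw ν))
    (hRi : Integrable (fun z => ∑ k ∈ Finset.range (τ z), C z k) (seqLaw ν)) :
    ∀ᵐ z ∂seqLaw ν, Tendsto (fun N : ℕ => (∑ k ∈ Finset.range N, C z k) / N) atTop
      (𝓝 ((∫ z, ∑ k ∈ Finset.range (τ z), C z k ∂seqLaw ν) / ∫ z, (τ z : ℝ) ∂seqLaw ν)) := by
  have hcausalτ := fun z z' h1 h2 => (hcausal z z' h1 h2).1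
  have hS := measurePreserving_shiftAt hτ hpos hcausalτ
  have hposi : ∀ᵐ z ∂seqLaw ν, ∀ i, 0 < τ ((shiftAt τ)^[i] z) :=
    ae_all_iff.2 fun i => (hS.iterate i).quasiMeasurePreserving.ae hpos
  have hτc : Measurable fun z : ℕ → E => (τ z : ℝ) := measurable_from_top.comp hτ
  have h1 := tendsto_average_cycles hτ hpos hτc
    (fun z z' h1 h2 => ⟨hcausalτ z z' h1 h2, by rw [hcausalτ z z' h1 h2]⟩) hτi
  have h2 := tendsto_average_cycles hτ hpos hRm
    (fun z z' h1 h2 => ⟨hcausalτ z z' h1 h2, by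
      obtain ⟨h3, h4⟩ := hcausal z z' h1 h2
      rw [h3]
      exact Finset.sum_congr rfl fun k hk => h4 k (Finset.mem_range.1 hk)⟩) hRi
  have ht : 0 < ∫ z, (τ z : ℝ) ∂seqLaw ν := by
    have : (1 : ℝ) ≤ ∫ z, (τ z : ℝ) ∂seqLaw ν := by
      have h : ∫ _, (1 : ℝ) ∂seqLaw ν ≤ ∫ z, (τ z : ℝ) ∂seqLaw ν := by
        refine integral_mono_ae (integrable_const _) hτi ?_
        filter_upwards [hpos] with z hz
        exact_mod_cast hz
      simpa using h
    linarith
  filter_upwards [hposi, h1, h2] with z hz h1 h2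
  -- `c n` is the end of the `n`-th cycle; from there on the rewards are those of the `n` times
  -- shifted sequence.
  set c : ℕ → ℕ := fun n => ∑ i ∈ Finset.range n, τ ((shiftAt τ)^[i] z) with hc
  have hCn : ∀ n k, C z (c n + k) = C ((shiftAt τ)^[n] z) k := by
    intro n
    induction n with
    | zero => intro k; simp [hc]
    | succ n ih =>
      intro k
      rw [show c (n + 1) = c n + τ ((shiftAt τ)^[n] z) from Finset.sum_range_succ _ _, add_assoc, ih,
        hreg _ (hz n), Function.iterate_succ_apply']
  have hsum : ∀ n, ∑ k ∈ Finset.range (c n), C z k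
      = ∑ i ∈ Finset.range n, ∑ k ∈ Finset.range (τ ((shiftAt τ)^[i] z)),
        C ((shiftAt τ)^[i] z) k := by
    intro n
    induction n with
    | zero => simp [hc]
    | succ n ih =>
      rw [show c (n + 1) = c n + τ ((shiftAt τ)^[n] z) from Finset.sum_range_succ _ _,
        Finset.sum_range_add, ih, Finset.sum_range_succ]
      simp only [hCn]
  refine tendsto_div_of_tendsto_along (A := fun N => ∑ k ∈ Finset.range N, C z k) (c := c) ?_ ht
    ?_ ?_
  · refine monotone_nat_of_le_succ fun n => ?_
    rw [Finset.sum_range_succ]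
    linarith [hC0 z n]
  · simpa [hc] using h1
  · simpa only [hsum] using h2

end Sequences

/-! ### The loop driven by a sequence of noise values and channel outcomes -/

section Loop

variable {a b K ε : ℝ} {T : ℕ}

/-- The state of the closed loop at time `k` when `z k` holds the process noise acting after time
`k` and the channel outcome at time `k + 1`. -/
noncomputable def loop (a b K ε : ℝ) (T : ℕ) (s : LoopState) (z : ℕ → ℝ × Bool) : ℕ → LoopState
  | 0 => s
  | k + 1 => step a b K ε T (loop a b K ε T s z k) (z k).1 (z k).2

lemma trajectory_eq_loop (s : LoopState) (w : ℕ → ℝ) (lost : ℕ → Bool) (k : ℕ) :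
    trajectory a b K ε T s w lost k = loop a b K ε T s (fun k => (w k, lost (k + 1))) k := by
  induction k with
  | zero => rfl
  | succ k ih => rw [trajectory, loop, ih]

lemma loop_add (s : LoopState) (z : ℕ → ℝ × Bool) (n k : ℕ) :
    loop a b K ε T s z (n + k) = loop a b K ε T (loop a b K ε T s z n) (shiftSeq n z) k := by
  induction k with
  | zero => rfl
  | succ k ih => rw [← add_assoc, loop, ih, loop, shiftSeq]

lemma loop_congr (s : LoopState) {z z' : ℕ → ℝ × Bool} {n : ℕ} (h : ∀ k < n, z k = z' k) :
    loop a b K ε T s z n = loop a b K ε T s z' n := by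
  induction n with
  | zero => rfl
  | succ n ih => rw [loop, loop, ih fun k hk => h k (by omega), h n (by omega)]

/-- After the reception of a packet, the loop evolves as if it were in the zero state. -/
lemma loop_of_reset (hK : a + b * K = 0) {s : LoopState} (hs : s.2 = (0, 0))
    (z : ℕ → ℝ × Bool) (k : ℕ) :
    loop a b K ε T s z (k + 1) = loop a b K ε T (0, 0, 0) z (k + 1) := by
  induction k with
  | zero =>
    obtain ⟨x, q⟩ := s
    obtain rfl : q = (0, 0) := hs
    have : plant a b K (x, 0, 0) (z 0).1 = plant a b K (0, 0, 0) (z 0).1 := by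
      simp only [plant, input, if_true]
      linear_combination x * hK
    simp only [loop, step, this]
  | succ k ih => rw [loop, ih]; rfl

@[fun_prop]
lemma measurable_input (K : ℝ) : Measurable (input K) := by
  unfold input
  refine Measurable.ite ?_ (measurable_fst.const_mul K) measurable_const
  exact measurable_snd (measurableSet_singleton _)

lemma measurable_step : Measurable fun q : LoopState × ℝ × Bool =>
    step a b K ε T q.1 q.2.1 q.2.2 := by
  have hp : Measurable fun q : LoopState × ℝ × Bool => plant a b K q.1 q.2.1 := by
    unfold plant
    fun_prop
  refine hp.prodMk ?_
  have hs : Measurable fun q : (ℕ × ℕ × Bool) × ℝ => schedule ε T q.1.1 q.1.2.1 q.2 q.1.2.2 := by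
    refine measurable_from_prod_countable_right fun q => ?_
    obtain ⟨r, γ, l⟩ := q
    have h : MeasurableSet {x : ℝ | ε < |x| ∨ T < r + 1 ∨ γ ≠ 0} :=
      (measurableSet_lt measurable_const measurable_norm).union (MeasurableSet.const _)
    exact Measurable.ite h (measurable_const (a := if l = true then (r, γ + 1) else (0, 0)))
      (measurable_const (a := (r + 1, 0)))
  exact hs.comp (Measurable.prodMk (f := fun q : LoopState × ℝ × Bool =>
    (q.1.2.1, q.1.2.2, q.2.2)) (by fun_prop) hp)

lemma measurable_loop (s : LoopState) (k : ℕ) :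
    Measurable fun z : ℕ → ℝ × Bool => loop a b K ε T s z k := by
  induction k with
  | zero => exact measurable_const
  | succ k ih => exact measurable_step.comp (ih.prodMk (measurable_pi_apply k))

/-- If no packet is lost during `T + 1` consecutive samples, then a packet is received. -/
lemma exists_reset_of_no_loss (s : LoopState) {z : ℕ → ℝ × Bool}
    (h : ∀ k ≤ T, (z k).2 = false) : ∃ k ≤ T, (loop a b K ε T s z (k + 1)).2 = (0, 0) := by
  by_contra! hc
  -- Without losses every attempt resets the pair, so without a reset `r` grows at each step. At
  -- time `T` this makes `T < r + 1`, and the time-out forces a successful attempt.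
  have key : ∀ j ≤ T + 1, j ≤ (loop a b K ε T s z j).2.1 := by
    intro j hj
    induction j with
    | zero => omega
    | succ j ih =>
      have h1 := hc j (by omega)
      have h3 := ih (by omega)
      simp only [loop, step, schedule, h j (by omega), Bool.false_eq_true, if_false] at h1 ⊢
      split_ifs at h1 ⊢
      · simp at h1
      · exact Nat.succ_le_succ h3
  have h1 := hc T le_rfl
  have h2 := key T (by omega)
  simp only [loop, step, schedule, h T le_rfl] at h1
  rw [if_pos (Or.inr (Or.inl (by omega)))] at h1
  simp at h1

/-! ### Cycles -/

/-- No packet is received at the times `1, …, k`, for the loop started in the zero state. -/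
def Alive (a b K ε : ℝ) (T k : ℕ) (z : ℕ → ℝ × Bool) : Prop :=
  ∀ j < k, (loop a b K ε T (0, 0, 0) z (j + 1)).2 ≠ (0, 0)

/-- The first positive time at which a packet is received, for the loop started in the zero state;
`0` if there is none. -/
noncomputable def cycleLength (a b K ε : ℝ) (T : ℕ) (z : ℕ → ℝ × Bool) : ℕ :=
  sInf {n | 0 < n ∧ (loop a b K ε T (0, 0, 0) z n).2 = (0, 0)}

/-- The infimum runs over positive numbers, so it is `0` only through the default `sInf ∅ = 0`. -/
lemma cycleLength_pos_iff {z : ℕ → ℝ × Bool} :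
    0 < cycleLength a b K ε T z ↔ ∃ n, (loop a b K ε T (0, 0, 0) z (n + 1)).2 = (0, 0) := by
  rw [Nat.pos_iff_ne_zero, cycleLength, Ne, Nat.sInf_eq_zero, not_or]
  constructor
  · rintro ⟨-, h⟩
    obtain ⟨n, hn, h⟩ := Set.nonempty_iff_ne_empty.2 h
    obtain ⟨m, rfl⟩ := Nat.exists_eq_add_of_lt hn
    exact ⟨0 + m, h⟩
  · rintro ⟨n, h⟩
    exact ⟨fun h => h.1.false, fun h' => by
      have : n + 1 ∈ {n | 0 < n ∧ (loop a b K ε T (0, 0, 0) z n).2 = (0, 0)} := ⟨by omega, h⟩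
      rw [h'] at this
      exact this⟩

lemma loop_cycleLength {z : ℕ → ℝ × Bool} (h : 0 < cycleLength a b K ε T z) :
    (loop a b K ε T (0, 0, 0) z (cycleLength a b K ε T z)).2 = (0, 0) := by
  obtain ⟨n, hn⟩ := cycleLength_pos_iff.1 h
  exact (Nat.sInf_mem (s := {n | 0 < n ∧ (loop a b K ε T (0, 0, 0) z n).2 = (0, 0)})
    ⟨n + 1, by omega, hn⟩).2

lemma alive_iff_lt_cycleLength {z : ℕ → ℝ × Bool} (h : 0 < cycleLength a b K ε T z) (k : ℕ) :
    Alive a b K ε T k z ↔ k < cycleLength a b K ε T z := by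
  constructor
  · intro hk
    by_contra! hle
    refine hk (cycleLength a b K ε T z - 1) (by omega) ?_
    rw [Nat.sub_add_cancel h]
    exact loop_cycleLength h
  · intro hk j hj hr
    have : cycleLength a b K ε T z ≤ j + 1 := Nat.sInf_le ⟨by omega, hr⟩
    omega

lemma cycleLength_eq_of_alive {z : ℕ → ℝ × Bool} {n : ℕ} (h : Alive a b K ε T n z)
    (hr : (loop a b K ε T (0, 0, 0) z (n + 1)).2 = (0, 0)) :
    cycleLength a b K ε T z = n + 1 := by
  have h0 : 0 < cycleLength a b K ε T z := cycleLength_pos_iff.2 ⟨n, hr⟩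
  have h1 := (alive_iff_lt_cycleLength h0 n).1 h
  have : cycleLength a b K ε T z ≤ n + 1 := Nat.sInf_le ⟨by omega, hr⟩
  omega

lemma measurableSet_alive (k : ℕ) : MeasurableSet {z | Alive a b K ε T k z} := by
  have : {z | Alive a b K ε T k z}
      = ⋂ j ∈ Set.Iio k, {z | (loop a b K ε T (0, 0, 0) z (j + 1)).2 ≠ (0, 0)} := by
    ext z
    simp [Alive]
  rw [this]
  refine MeasurableSet.biInter (Set.to_countable _) fun j _ => ?_
  exact (measurable_loop _ (j + 1)).snd (measurableSet_singleton _).compl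

lemma measurable_cycleLength : Measurable (cycleLength a b K ε T) := by
  have hs : ∀ n, MeasurableSet (cycleLength a b K ε T ⁻¹' {n + 1}) := by
    intro n
    have : cycleLength a b K ε T ⁻¹' {n + 1} = {z | Alive a b K ε T n z}
        ∩ {z | (loop a b K ε T (0, 0, 0) z (n + 1)).2 = (0, 0)} := by
      ext z
      constructor
      · intro h
        have h' : cycleLength a b K ε T z = n + 1 := h
        have h0 : 0 < cycleLength a b K ε T z := by omega
        exact ⟨(alive_iff_lt_cycleLength h0 n).2 (by omega), h' ▸ loop_cycleLength h0⟩
      · rintro ⟨h1, h2⟩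
        exact cycleLength_eq_of_alive h1 h2
    rw [this]
    exact (measurableSet_alive n).inter
      ((measurable_loop _ (n + 1)).snd (measurableSet_singleton _))
  refine measurable_to_countable' fun n => ?_
  cases n with
  | succ n => exact hs n
  | zero =>
    have : cycleLength a b K ε T ⁻¹' {0} = (⋃ n, cycleLength a b K ε T ⁻¹' {n + 1})ᶜ := by
      ext z
      simp only [Set.mem_preimage, Set.mem_singleton_iff, Set.mem_compl_iff, Set.mem_iUnion,
        not_exists]
      constructor
      · intro h n; omega
      · intro h
        by_contra h0
        exact h (cycleLength a b K ε T z - 1) (by omega)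
    rw [this]
    exact (MeasurableSet.iUnion hs).compl

/-- Stopping-time property of the cycle length: the state at time `k + 1` uses only `z 0, …, z k`.
-/
lemma cycle_congr {z z' : ℕ → ℝ × Bool} (h : 0 < cycleLength a b K ε T z)
    (hz : ∀ k < cycleLength a b K ε T z, z k = z' k) :
    cycleLength a b K ε T z' = cycleLength a b K ε T z ∧
      ∀ k < cycleLength a b K ε T z,
        loop a b K ε T (0, 0, 0) z' (k + 1) = loop a b K ε T (0, 0, 0) z (k + 1) := by
  have hl : ∀ k < cycleLength a b K ε T z,
      loop a b K ε T (0, 0, 0) z' (k + 1) = loop a b K ε T (0, 0, 0) z (k + 1) :=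
    fun k hk => loop_congr _ fun j hj => (hz j (by omega)).symm
  refine ⟨?_, hl⟩
  obtain ⟨n, hn⟩ : ∃ n, cycleLength a b K ε T z = n + 1 := ⟨_, (Nat.sub_add_cancel h).symm⟩
  rw [hn]
  refine cycleLength_eq_of_alive (fun j hj => ?_) ?_
  · rw [hl j (by omega)]
    exact (alive_iff_lt_cycleLength h n).2 (by omega) j hj
  · rw [hl n (by omega), ← hn]
    exact loop_cycleLength h

/-- Regeneration. At the reception itself the plant state still carries the past; only the later
states are those of a fresh loop. A cycle therefore comprises the times `1, …, cycleLength`, with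
its reception at the end. -/
lemma loop_cycleLength_add (hK : a + b * K = 0) {z : ℕ → ℝ × Bool}
    (h : 0 < cycleLength a b K ε T z) (k : ℕ) :
    loop a b K ε T (0, 0, 0) z (cycleLength a b K ε T z + k + 1)
      = loop a b K ε T (0, 0, 0) (shiftAt (cycleLength a b K ε T) z) (k + 1) := by
  rw [add_assoc, loop_add, loop_of_reset hK (loop_cycleLength h), shiftAt]

/-! ### The course of a cycle -/

/-- The plant state `i + 1` steps after a reset if there is no further input. -/
noncomputable def drift (a : ℝ) (W : ℕ → ℝ) : ℕ → ℝ
  | 0 => W 0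
  | i + 1 => a * drift a W i + W (i + 1)

lemma xi_eq_drift {Ω : Type*} (a : ℝ) (w : ℕ → Ω → ℝ) (i : ℕ) (ω : Ω) :
    xi a w i ω = drift a (fun k => w k ω) i := by
  induction i with
  | zero => simp [xi, drift]
  | succ i ih =>
    rw [xi, Finset.sum_range_succ', drift, ← ih, xi, Finset.mul_sum]
    simp only [pow_zero, one_mul, Nat.sub_zero]
    congr 1
    refine Finset.sum_congr rfl fun j _ => ?_
    rw [pow_succ', mul_assoc, Nat.add_sub_add_right]

/-- The threshold is not exceeded during the first `i` steps. -/
def quietSet (a ε : ℝ) (i : ℕ) : Set (ℕ → ℝ) := {W | ∀ j < i, |drift a W j| ≤ ε}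

/-- The first transmission of a cycle is attempted at time `i + 1`. -/
def attemptSet (a ε : ℝ) (T i : ℕ) : Set (ℕ → ℝ) :=
  {W | i ≤ T ∧ W ∈ quietSet a ε i ∧ (i < T → ε < |drift a W i|)}

lemma attemptSet_disjoint {i j : ℕ} {W : ℕ → ℝ} (hi : W ∈ attemptSet a ε T i)
    (hj : W ∈ attemptSet a ε T j) : i = j := by
  rcases lt_trichotomy i j with h | h | h
  · exact absurd (hj.2.1 i h) (not_le.2 (hi.2.2 (h.trans_le hj.1)))
  · exact h
  · exact absurd (hi.2.1 j h) (not_le.2 (hj.2.2 (h.trans_le hi.1)))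

lemma notMem_quietSet_of_attempt {i k : ℕ} {W : ℕ → ℝ} (hi : W ∈ attemptSet a ε T i)
    (hik : i < k) (hk : k ≤ T) : W ∉ quietSet a ε k :=
  fun h => absurd (h i hik) (not_le.2 (hi.2.2 (hik.trans_le hk)))

/-- The noise part of a driving sequence. -/
def noise (z : ℕ → ℝ × Bool) (k : ℕ) : ℝ := (z k).1

/-- All transmissions from the time `i + 1` to the time `k` are lost. -/
def LostOn (i k : ℕ) (z : ℕ → ℝ × Bool) : Prop := ∀ j, i ≤ j → j < k → (z j).2 = true

/-- The induction carries the next plant state instead of the current one. This includes `k = 0`,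
where the input `K * 0` vanishes although the pair is `(0, 0)`. -/
lemma loop_of_quiet {z : ℕ → ℝ × Bool} {k : ℕ} (hk : k ≤ T) (h : noise z ∈ quietSet a ε k) :
    (loop a b K ε T (0, 0, 0) z k).2 = (k, 0) ∧
      plant a b K (loop a b K ε T (0, 0, 0) z k) (z k).1 = drift a (noise z) k := by
  induction k with
  | zero => simp [loop, plant, input, drift, noise]
  | succ k ih =>
    obtain ⟨h1, h2⟩ := ih (by omega) fun j hj => h j (by omega)
    have h3 : loop a b K ε T (0, 0, 0) z (k + 1) = (drift a (noise z) k, k + 1, 0) := by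
      rw [loop, step, h2, h1, schedule, if_neg]
      push Not
      exact ⟨h k (by omega), by omega, rfl⟩
    rw [h3]
    refine ⟨rfl, ?_⟩
    simp [plant, input, drift, noise]

/-- The attempt at time `i + 1` is due to the crossing, or to the time-out if `i = T`; each later
one is due to `γ ≠ 0`. -/
lemma loop_of_lostOn {z : ℕ → ℝ × Bool} {i : ℕ} (hi : noise z ∈ attemptSet a ε T i) (m : ℕ)
    (hl : LostOn i (i + m) z) :
    (loop a b K ε T (0, 0, 0) z (i + m)).2 = (i, m) ∧
      plant a b K (loop a b K ε T (0, 0, 0) z (i + m)) (z (i + m)).1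
        = drift a (noise z) (i + m) := by
  induction m with
  | zero => exact loop_of_quiet hi.1 hi.2.1
  | succ m ih =>
    obtain ⟨h1, h2⟩ := ih fun j h1 h2 => hl j h1 (by omega)
    have h3 : loop a b K ε T (0, 0, 0) z (i + (m + 1))
        = (drift a (noise z) (i + m), i, m + 1) := by
      rw [← add_assoc, loop, step, h2, h1, schedule, if_pos, hl (i + m) (by omega) (by omega),
        if_pos rfl]
      rcases Nat.eq_zero_or_pos m with rfl | hm
      · rcases hi.1.lt_or_eq with h | h
        · exact Or.inl (hi.2.2 h)
        · exact Or.inr (Or.inl (by omega))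
      · exact Or.inr (Or.inr (by simp; omega))
    rw [h3]
    refine ⟨rfl, ?_⟩
    simp [plant, input, drift, noise, ← add_assoc]

lemma loop_succ_of_quiet {z : ℕ → ℝ × Bool} {k : ℕ} (hk : k < T)
    (h : noise z ∈ quietSet a ε (k + 1)) :
    loop a b K ε T (0, 0, 0) z (k + 1) = (drift a (noise z) k, k + 1, 0) := by
  obtain ⟨h1, -⟩ := loop_of_quiet (b := b) (K := K) (Nat.succ_le_of_lt hk) h
  obtain ⟨-, h2⟩ := loop_of_quiet (b := b) (K := K) hk.le fun j (hj : j < k) => h j (by omega)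
  refine Prod.ext ?_ h1
  rw [loop, step, h2]

lemma loop_succ_of_lostOn {z : ℕ → ℝ × Bool} {i : ℕ} (hi : noise z ∈ attemptSet a ε T i) (m : ℕ)
    (hl : LostOn i (i + m) z) :
    loop a b K ε T (0, 0, 0) z (i + m + 1) = (drift a (noise z) (i + m),
      if (z (i + m)).2 = true then (i, m + 1) else (0, 0)) := by
  obtain ⟨h1, h2⟩ := loop_of_lostOn (b := b) (K := K) hi m hl
  rw [loop, step, h2, h1, schedule, if_pos]
  rcases Nat.eq_zero_or_pos m with rfl | hm
  · rcases hi.1.lt_or_eq with h | h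
    · exact Or.inl (hi.2.2 h)
    · exact Or.inr (Or.inl (by omega))
  · exact Or.inr (Or.inr (by simp; omega))

lemma alive_of_quiet {z : ℕ → ℝ × Bool} {k : ℕ} (hk : k ≤ T) (h : noise z ∈ quietSet a ε k) :
    Alive a b K ε T k z := fun j hj => by
  rw [(loop_of_quiet (by omega : j + 1 ≤ T) fun l hl => h l (by omega)).1]
  simp

lemma alive_of_lostOn {z : ℕ → ℝ × Bool} {i k : ℕ}
    (hi : noise z ∈ attemptSet a ε T i) (hl : LostOn i k z) : Alive a b K ε T k z := by
  intro j hj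
  rcases lt_or_ge j i with h | h
  · exact alive_of_quiet hi.1 hi.2.1 j h
  · obtain ⟨m, rfl⟩ := Nat.exists_eq_add_of_le h
    rw [loop_succ_of_lostOn hi m fun l h1 h2 => hl l h1 (by omega), hl _ h hj]
    simp

/-- The alternatives look one step ahead, asking whether there has been an attempt by time `k + 1`.
This fixes the plant state at that time, and the pair up to the channel outcome `z k`. -/
lemma alive_iff {z : ℕ → ℝ × Bool} {k : ℕ} : Alive a b K ε T k z ↔
    (k < T ∧ noise z ∈ quietSet a ε (k + 1)) ∨
      ∃ i ≤ k, noise z ∈ attemptSet a ε T i ∧ LostOn i k z := by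
  have split : ∀ k ≤ T, noise z ∈ quietSet a ε k → (k < T ∧ noise z ∈ quietSet a ε (k + 1)) ∨
      ∃ i ≤ k, noise z ∈ attemptSet a ε T i ∧ LostOn i k z := by
    intro k hk h
    by_cases hD : noise z ∈ attemptSet a ε T k
    · exact Or.inr ⟨k, le_rfl, hD, fun j h1 h2 => by omega⟩
    · have : k < T ∧ |drift a (noise z) k| ≤ ε := by
        by_contra hc
        exact hD ⟨hk, h, fun hkT => not_le.1 fun hle => hc ⟨hkT, hle⟩⟩
      refine Or.inl ⟨this.1, fun j hj => ?_⟩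
      rcases Nat.lt_succ_iff_lt_or_eq.1 hj with h' | rfl
      · exact h j h'
      · exact this.2
  constructor
  · intro h
    induction k with
    | zero => exact split 0 (Nat.zero_le _) fun j hj => by omega
    | succ k ih =>
      rcases ih fun j hj => h j (by omega) with ⟨h1, h2⟩ | ⟨i, hik, h1, h2⟩
      · exact split (k + 1) h1 h2
      · refine Or.inr ⟨i, by omega, h1, fun j h3 h4 => ?_⟩
        rcases Nat.lt_succ_iff_lt_or_eq.1 h4 with h' | rfl
        · exact h2 j h3 h'
        · obtain ⟨m, rfl⟩ := Nat.exists_eq_add_of_le hik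
          have h5 := h (i + m) (by omega)
          rw [loop_succ_of_lostOn h1 m h2] at h5
          by_contra hc
          simp [hc] at h5
  · rintro (⟨h1, h2⟩ | ⟨i, hik, h1, h2⟩)
    · exact fun j hj => alive_of_quiet h1 h2 j (by omega)
    · exact alive_of_lostOn h1 h2

end Loop

/-! ### Expected costs per cycle -/

section Expectation

open scoped ENNReal

variable {a b K ε : ℝ} {T : ℕ}

/-- The channel part of a driving sequence. -/
def losses (z : ℕ → ℝ × Bool) (k : ℕ) : Bool := (z k).2

@[fun_prop]
lemma measurable_noise : Measurable noise :=
  measurable_pi_iff.2 fun k => measurable_fst.comp (measurable_pi_apply k)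

@[fun_prop]
lemma measurable_losses : Measurable losses :=
  measurable_pi_iff.2 fun k => measurable_snd.comp (measurable_pi_apply k)

@[fun_prop]
lemma measurable_drift (a : ℝ) (i : ℕ) : Measurable fun W : ℕ → ℝ => drift a W i := by
  induction i with
  | zero => exact measurable_pi_apply 0
  | succ i ih => exact (ih.const_mul a).add (measurable_pi_apply (i + 1))

lemma measurableSet_quietSet (a ε : ℝ) (i : ℕ) : MeasurableSet (quietSet a ε i) := by
  have : quietSet a ε i = ⋂ j ∈ Set.Iio i, {W | |drift a W j| ≤ ε} := by
    ext W
    simp [quietSet]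
  rw [this]
  refine MeasurableSet.biInter (Set.to_countable _) fun j _ => ?_
  exact measurableSet_le (measurable_norm.comp (measurable_drift a j)) measurable_const

lemma measurableSet_attemptSet (a ε : ℝ) (T i : ℕ) : MeasurableSet (attemptSet a ε T i) := by
  have : attemptSet a ε T i = {W | i ≤ T} ∩ (quietSet a ε i ∩
      ({W | ¬ i < T} ∪ {W | ε < |drift a W i|})) := by
    ext W
    simp [attemptSet, imp_iff_not_or]
  rw [this]
  exact (MeasurableSet.const _).inter ((measurableSet_quietSet a ε i).inter
    ((MeasurableSet.const _).union (measurableSet_lt measurable_const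
      (measurable_norm.comp (measurable_drift a i)))))

/-- All transmissions from the time `i + 1` to the time `k` are lost. -/
def lostSet (i k : ℕ) : Set (ℕ → Bool) := {L | ∀ j, i ≤ j → j < k → L j = true}

/-- The first successful transmission at or after the time `i + 1` is at the time `k + 1`. -/
def lostUntilSet (i k : ℕ) : Set (ℕ → Bool) := lostSet i k ∩ {L | L k = false}

lemma measurableSet_lostSet (i k : ℕ) : MeasurableSet (lostSet i k) := by
  have : lostSet i k = ⋂ j ∈ Set.Ico i k, {L | L j = true} := by
    ext L
    simp [lostSet]
  rw [this]
  exact MeasurableSet.biInter (Set.to_countable _) fun j _ =>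
    measurableSet_eq_fun (measurable_pi_apply j) measurable_const

lemma measurableSet_lostUntilSet (i k : ℕ) : MeasurableSet (lostUntilSet i k) :=
  (measurableSet_lostSet i k).inter (measurableSet_eq_fun (measurable_pi_apply k) measurable_const)

/-- The value of a nonnegative cost at time `k + 1`, as long as the cycle has not ended. -/
lemma indicator_alive_eq (g₀ g₁ : ℝ → ℝ≥0∞) (z : ℕ → ℝ × Bool) (k : ℕ) :
    {z | Alive a b K ε T k z}.indicator (fun z =>
        if (loop a b K ε T (0, 0, 0) z (k + 1)).2 = (0, 0)
          then g₀ (loop a b K ε T (0, 0, 0) z (k + 1)).1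
          else g₁ (loop a b K ε T (0, 0, 0) z (k + 1)).1) z
      = (if k < T then (quietSet a ε (k + 1)).indicator (fun W => g₁ (drift a W k)) (noise z)
          else 0)
        + ∑ q ∈ Finset.HasAntidiagonal.antidiagonal k,
          ((attemptSet a ε T q.1).indicator (fun W => g₁ (drift a W (q.1 + q.2))) (noise z)
              * (lostSet q.1 (q.1 + q.2 + 1)).indicator 1 (losses z)
            + (attemptSet a ε T q.1).indicator (fun W => g₀ (drift a W (q.1 + q.2))) (noise z)
              * (lostUntilSet q.1 (q.1 + q.2)).indicator 1 (losses z)) := by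
  have sum_zero : (∀ i ≤ k, noise z ∈ attemptSet a ε T i → ¬ LostOn i k z) →
      ∑ q ∈ Finset.HasAntidiagonal.antidiagonal k,
          ((attemptSet a ε T q.1).indicator (fun W => g₁ (drift a W (q.1 + q.2))) (noise z)
              * (lostSet q.1 (q.1 + q.2 + 1)).indicator 1 (losses z)
            + (attemptSet a ε T q.1).indicator (fun W => g₀ (drift a W (q.1 + q.2))) (noise z)
              * (lostUntilSet q.1 (q.1 + q.2)).indicator 1 (losses z)) = (0 : ℝ≥0∞) := by
    intro h
    refine Finset.sum_eq_zero fun q hq => ?_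
    have hq := Finset.HasAntidiagonal.mem_antidiagonal.1 hq
    by_cases hD : noise z ∈ attemptSet a ε T q.1
    · have h1 := h q.1 (by omega) hD
      rw [Set.indicator_of_notMem (s := lostSet q.1 (q.1 + q.2 + 1)),
        Set.indicator_of_notMem (s := lostUntilSet q.1 (q.1 + q.2)), mul_zero, mul_zero, add_zero]
      · exact fun hl => h1 (hq ▸ hl.1)
      · exact fun hl => h1 fun j h2 h3 => hl j h2 (by omega)
    · simp [Set.indicator_of_notMem hD]
  by_cases hA : k < T ∧ noise z ∈ quietSet a ε (k + 1)
  · rw [Set.indicator_of_mem (alive_iff.2 (Or.inl hA)), if_pos hA.1,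
      Set.indicator_of_mem hA.2, sum_zero, loop_succ_of_quiet hA.1 hA.2]
    · simp
    · intro i hi hD
      exact absurd hA.2 (notMem_quietSet_of_attempt hD (by omega) (by omega))
  have hA0 : (if k < T then (quietSet a ε (k + 1)).indicator (fun W => g₁ (drift a W k)) (noise z)
      else 0) = 0 := by
    split_ifs with h
    · exact Set.indicator_of_notMem (fun h' => hA ⟨h, h'⟩) _
    · rfl
  rw [hA0, zero_add]
  by_cases hB : ∃ i ≤ k, noise z ∈ attemptSet a ε T i ∧ LostOn i k z
  · rw [Set.indicator_of_mem (alive_iff.2 (Or.inr hB))]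
    obtain ⟨i, hik, hD, hl⟩ := hB
    obtain ⟨m, rfl⟩ := Nat.exists_eq_add_of_le hik
    -- The attempt events are disjoint, so only the actual first attempt time contributes. The
    -- outcome at time `i + m + 1` then selects between its two terms.
    rw [Finset.sum_eq_single (i, m)]
    · simp only [Set.indicator_of_mem hD]
      rw [loop_succ_of_lostOn hD m hl]
      by_cases hz : (z (i + m)).2 = true
      · rw [Set.indicator_of_mem, Set.indicator_of_notMem]
        · simp [hz]
        · exact fun h => by simpa [losses, hz] using h.2
        · intro j h1 h2
          rcases Nat.lt_succ_iff_lt_or_eq.1 h2 with h | rfl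
          · exact hl j h1 h
          · exact hz
      · rw [Set.indicator_of_notMem, Set.indicator_of_mem]
        · simp [hz]
        · exact ⟨hl, by simpa [losses] using hz⟩
        · exact fun h => hz (h (i + m) (by omega) (by omega))
    · intro q hq hne
      have hq := Finset.HasAntidiagonal.mem_antidiagonal.1 hq
      have : noise z ∉ attemptSet a ε T q.1 := fun h => by
        have h1 := attemptSet_disjoint h hD
        exact hne (Prod.ext h1 (by simp only; omega))
      simp [Set.indicator_of_notMem this]
    · simp
  · rw [Set.indicator_of_notMem, sum_zero]
    · exact fun i hi hD hl => hB ⟨i, hi, hD, hl⟩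
    · intro h
      rcases alive_iff.1 h with h | h
      · exact hA h
      · exact hB h

/-- Passes from a sum over times `k` to a sum over the first attempt `i` and the number `m` of
losses, where `k = i + m`. -/
lemma tsum_sum_antidiagonal (f : ℕ × ℕ → ℝ≥0∞) :
    ∑' n, ∑ q ∈ Finset.HasAntidiagonal.antidiagonal n, f q = ∑' i, ∑' m, f (i, m) := by
  rw [← ENNReal.tsum_prod' (f := f), ← Finset.HasAntidiagonal.sigmaAntidiagonalEquivProd.tsum_eq,
    ENNReal.tsum_sigma']
  refine tsum_congr fun n => ?_
  rw [← Finset.sum_coe_sort, tsum_fintype]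
  rfl

/-- The expected cost of a cycle. -/
lemma tsum_lintegral_alive {μ : Measure (ℕ → ℝ × Bool)} {p : ℝ≥0∞}
    (hind : IndepFun noise losses μ)
    (hlost : ∀ i m, μ.map losses (lostSet i (i + m)) = p ^ m)
    (hlostU : ∀ i m, μ.map losses (lostUntilSet i (i + m)) = p ^ m * (1 - p))
    {g₀ g₁ : ℝ → ℝ≥0∞} (h₀ : Measurable g₀) (h₁ : Measurable g₁) :
    ∑' k, ∫⁻ z, {z | Alive a b K ε T k z}.indicator (fun z =>
        if (loop a b K ε T (0, 0, 0) z (k + 1)).2 = (0, 0)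
          then g₀ (loop a b K ε T (0, 0, 0) z (k + 1)).1
          else g₁ (loop a b K ε T (0, 0, 0) z (k + 1)).1) z ∂μ
      = ∑ k ∈ Finset.range T, ∫⁻ W in quietSet a ε (k + 1), g₁ (drift a W k) ∂μ.map noise
        + ∑ i ∈ Finset.range (T + 1), ∑' m,
          (p ^ (m + 1) * ∫⁻ W in attemptSet a ε T i, g₁ (drift a W (i + m)) ∂μ.map noise
            + p ^ m * (1 - p) *
              ∫⁻ W in attemptSet a ε T i, g₀ (drift a W (i + m)) ∂μ.map noise) := by
  -- Independence of noise and channel factors each term into a loss probability and a noise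
  -- integral.
  have hterm : ∀ (g : ℝ → ℝ≥0∞), Measurable g → ∀ (i k : ℕ) (S : Set (ℕ → Bool)),
      MeasurableSet S →
      ∫⁻ z, (attemptSet a ε T i).indicator (fun W => g (drift a W k)) (noise z)
        * S.indicator 1 (losses z) ∂μ
      = μ.map losses S * ∫⁻ W in attemptSet a ε T i, g (drift a W k) ∂μ.map noise := by
    intro g hg i k S hS
    have hm : Measurable ((attemptSet a ε T i).indicator fun W => g (drift a W k)) :=
      (hg.comp (measurable_drift a k)).indicator (measurableSet_attemptSet a ε T i)
    have hm' : Measurable (S.indicator (1 : (ℕ → Bool) → ℝ≥0∞)) := measurable_one.indicator hS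
    have h := lintegral_mul_eq_lintegral_mul_lintegral_of_indepFun
      (hm.comp measurable_noise) (hm'.comp measurable_losses) (hind.comp hm hm')
    simp only [Pi.mul_apply, Function.comp_apply] at h
    rw [h, mul_comm]
    congr 1
    · rw [← lintegral_map hm' measurable_losses, lintegral_indicator_one hS]
    · rw [← lintegral_map hm measurable_noise,
        lintegral_indicator (measurableSet_attemptSet a ε T i)]
  have hk : ∀ k, ∫⁻ z, {z | Alive a b K ε T k z}.indicator (fun z =>
        if (loop a b K ε T (0, 0, 0) z (k + 1)).2 = (0, 0)
          then g₀ (loop a b K ε T (0, 0, 0) z (k + 1)).1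
          else g₁ (loop a b K ε T (0, 0, 0) z (k + 1)).1) z ∂μ
      = (if k < T then ∫⁻ W in quietSet a ε (k + 1), g₁ (drift a W k) ∂μ.map noise else 0)
        + ∑ q ∈ Finset.HasAntidiagonal.antidiagonal k,
          (p ^ (q.2 + 1) * ∫⁻ W in attemptSet a ε T q.1, g₁ (drift a W (q.1 + q.2)) ∂μ.map noise
            + p ^ q.2 * (1 - p) *
              ∫⁻ W in attemptSet a ε T q.1, g₀ (drift a W (q.1 + q.2)) ∂μ.map noise) := by
    intro k
    have hmi : ∀ (g : ℝ → ℝ≥0∞), Measurable g → ∀ (i k : ℕ) (S : Set (ℕ → Bool)),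
        MeasurableSet S → Measurable fun z =>
          (attemptSet a ε T i).indicator (fun W => g (drift a W k)) (noise z)
            * S.indicator (1 : (ℕ → Bool) → ℝ≥0∞) (losses z) := fun g hg i k S hS =>
      (((hg.comp (measurable_drift a k)).indicator (measurableSet_attemptSet a ε T i)).comp
        measurable_noise).mul ((measurable_one.indicator hS).comp measurable_losses)
    have hq : Measurable ((quietSet a ε (k + 1)).indicator fun W => g₁ (drift a W k)) :=
      (h₁.comp (measurable_drift a k)).indicator (measurableSet_quietSet a ε _)
    simp only [indicator_alive_eq]
    rw [lintegral_add_left, lintegral_finsetSum]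
    · congr 1
      · split_ifs
        · rw [← lintegral_map hq measurable_noise,
            lintegral_indicator (measurableSet_quietSet a ε _)]
        · simp
      · refine Finset.sum_congr rfl fun q _ => ?_
        rw [lintegral_add_left (hmi g₁ h₁ _ _ _ (measurableSet_lostSet _ _)),
          hterm g₁ h₁ _ _ _ (measurableSet_lostSet _ _),
          hterm g₀ h₀ _ _ _ (measurableSet_lostUntilSet _ _), add_assoc, hlost, hlostU]
    · intro q _
      exact (hmi g₁ h₁ _ _ _ (measurableSet_lostSet _ _)).add
        (hmi g₀ h₀ _ _ _ (measurableSet_lostUntilSet _ _))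
    · split_ifs
      · exact hq.comp measurable_noise
      · exact measurable_const
  simp only [hk]
  rw [ENNReal.tsum_add, tsum_sum_antidiagonal fun q =>
    p ^ (q.2 + 1) * ∫⁻ W in attemptSet a ε T q.1, g₁ (drift a W (q.1 + q.2)) ∂μ.map noise
            + p ^ q.2 * (1 - p) *
              ∫⁻ W in attemptSet a ε T q.1, g₀ (drift a W (q.1 + q.2)) ∂μ.map noise]
  congr 1
  · rw [tsum_eq_sum (s := Finset.range T)]
    · exact Finset.sum_congr rfl fun k hk => if_pos (Finset.mem_range.1 hk)
    · exact fun k hk => if_neg fun h => hk (Finset.mem_range.2 h)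
  · rw [tsum_eq_sum (s := Finset.range (T + 1))]
    intro i hi
    have : attemptSet a ε T i = ∅ :=
      Set.eq_empty_of_forall_notMem fun W hW => hi (Finset.mem_range.2 (Nat.lt_succ_of_le hW.1))
    simp [this]

end Expectation

/-! ### Second moments of the drifting plant state -/

section Moments

variable {a ε : ℝ} {T : ℕ}

lemma drift_truncSeq (a e : ℝ) (W : ℕ → ℝ) {i n : ℕ} (h : i < n) :
    drift a (truncSeq e n W) i = drift a W i := by
  induction i with
  | zero => exact truncSeq_of_lt e W h
  | succ i ih => rw [drift, drift, ih (by omega), truncSeq_of_lt e W h]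

lemma mem_quietSet_truncSeq (e : ℝ) (W : ℕ → ℝ) {i n : ℕ} (h : i ≤ n) :
    W ∈ quietSet a ε i ↔ truncSeq e n W ∈ quietSet a ε i :=
  forall₂_congr fun j hj => by rw [drift_truncSeq a e W (by omega)]

lemma mem_attemptSet_truncSeq (e : ℝ) (W : ℕ → ℝ) {i n : ℕ} (h : i < n) :
    W ∈ attemptSet a ε T i ↔ truncSeq e n W ∈ attemptSet a ε T i := by
  simp only [attemptSet, Set.mem_ofPred_eq, drift_truncSeq a e W h,
    ← mem_quietSet_truncSeq e W h.le]

lemma drift_neg (a : ℝ) (W : ℕ → ℝ) (i : ℕ) : drift a (-W) i = -drift a W i := by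
  induction i with
  | zero => rfl
  | succ i ih =>
    rw [drift, drift, ih, Pi.neg_apply]
    ring

lemma neg_mem_quietSet (W : ℕ → ℝ) (i : ℕ) : -W ∈ quietSet a ε i ↔ W ∈ quietSet a ε i := by
  simp only [quietSet, Set.mem_ofPred_eq, drift_neg, abs_neg]

lemma neg_mem_attemptSet (W : ℕ → ℝ) (i : ℕ) :
    -W ∈ attemptSet a ε T i ↔ W ∈ attemptSet a ε T i := by
  simp only [attemptSet, Set.mem_ofPred_eq, drift_neg, abs_neg, neg_mem_quietSet]

variable {ν : Measure ℝ} [IsProbabilityMeasure ν]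

lemma measurePreserving_eval_seqLaw (k : ℕ) :
    MeasurePreserving (fun W : ℕ → ℝ => W k) (seqLaw ν) ν :=
  measurePreserving_eval_infinitePi (fun _ => ν) k

lemma integral_eval_seqLaw {g : ℝ → ℝ} (hg : Measurable g) (k : ℕ) :
    ∫ W : ℕ → ℝ, g (W k) ∂seqLaw ν = ∫ x, g x ∂ν := by
  have h := integral_map (μ := seqLaw ν) (φ := fun W : ℕ → ℝ => W k)
    (measurable_pi_apply k).aemeasurable (f := g) hg.aestronglyMeasurable
  rw [(measurePreserving_eval_seqLaw (ν := ν) k).map_eq] at h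
  exact h.symm

lemma memLp_drift (h2 : MemLp id 2 ν) (a : ℝ) (i : ℕ) :
    MemLp (fun W => drift a W i) 2 (seqLaw ν) := by
  have hk : ∀ k, MemLp (fun W : ℕ → ℝ => W k) 2 (seqLaw ν) := fun k =>
    h2.comp_measurePreserving (measurePreserving_eval_seqLaw k)
  induction i with
  | zero => exact hk 0
  | succ i ih => exact (ih.const_mul a).add (hk (i + 1))

lemma integrable_drift_sq (h2 : MemLp id 2 ν) (a : ℝ) (i : ℕ) :
    Integrable (fun W => drift a W i ^ 2) (seqLaw ν) := (memLp_drift h2 a i).integrable_sq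

/-- One step of the plant adds the variance of the process noise. -/
lemma setIntegral_drift_sq_succ (h2 : MemLp id 2 ν) (hm : ∫ x, x ∂ν = 0) {s : ℝ}
    (hs : ∫ x, x ^ 2 ∂ν = s) {D : Set (ℕ → ℝ)} (hD : MeasurableSet D) (n : ℕ)
    (hdep : ∀ W, W ∈ D ↔ truncSeq 0 (n + 1) W ∈ D) :
    ∫ W in D, drift a W (n + 1) ^ 2 ∂seqLaw ν
      = a ^ 2 * ∫ W in D, drift a W n ^ 2 ∂seqLaw ν + s * (seqLaw ν).real D := by
  have hind := indepFun_truncSeq_shiftSeq (fun k => measurable_pi_apply k)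
    (iIndepFun_seqLaw ν) 0 (n + 1)
  have hevm : Measurable fun V : ℕ → ℝ => V 0 := measurable_pi_apply 0
  have hmem : MemLp (fun W : ℕ → ℝ => W (n + 1)) 2 (seqLaw ν) :=
    h2.comp_measurePreserving (measurePreserving_eval_seqLaw (n + 1))
  have hm1 : ∫ W : ℕ → ℝ, W (n + 1) ∂seqLaw ν = 0 :=
    (integral_eval_seqLaw measurable_id (n + 1)).trans hm
  have hm2 : ∫ W : ℕ → ℝ, W (n + 1) ^ 2 ∂seqLaw ν = s :=
    (integral_eval_seqLaw (measurable_id.pow_const 2) (n + 1)).trans hs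
  -- Both indicator functions factor through the terms before `n + 1`, hence are independent of `W
  -- (n + 1)`. The cross term in the square then vanishes because the noise is centered.
  have e1 : (fun W => D.indicator (fun W => drift a W n) (truncSeq 0 (n + 1) W))
      = D.indicator fun W => drift a W n := by
    ext W
    by_cases h : W ∈ D
    · rw [Set.indicator_of_mem ((hdep W).1 h), Set.indicator_of_mem h,
        drift_truncSeq a 0 W (Nat.lt_succ_self n)]
    · rw [Set.indicator_of_notMem (mt (hdep W).2 h), Set.indicator_of_notMem h]
  have e2 : (fun W => D.indicator (fun _ => (1 : ℝ)) (truncSeq 0 (n + 1) W))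
      = D.indicator fun _ => 1 := by
    ext W
    by_cases h : W ∈ D
    · rw [Set.indicator_of_mem ((hdep W).1 h), Set.indicator_of_mem h]
    · rw [Set.indicator_of_notMem (mt (hdep W).2 h), Set.indicator_of_notMem h]
  have i1 : IndepFun (D.indicator fun W => drift a W n) (fun W : ℕ → ℝ => W (n + 1))
      (seqLaw ν) := by
    rw [← e1]
    exact hind.comp ((measurable_drift a n).indicator hD) hevm
  have i2 : IndepFun (D.indicator fun _ => (1 : ℝ)) (fun W : ℕ → ℝ => W (n + 1) ^ 2)
      (seqLaw ν) := by
    rw [← e2]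
    exact hind.comp (measurable_const.indicator hD) (hevm.pow_const 2)
  have c1 : ∫ W in D, drift a W n * W (n + 1) ∂seqLaw ν = 0 := by
    rw [← integral_indicator hD]
    have := i1.integral_fun_mul_eq_mul_integral
      ((measurable_drift a n).indicator hD).aestronglyMeasurable
      (measurable_pi_apply _).aestronglyMeasurable
    rw [hm1, mul_zero] at this
    rw [← this]
    congr 1 with W
    exact Set.indicator_mul_left D (fun W => drift a W n) fun W => W (n + 1)
  have c2 : ∫ W in D, W (n + 1) ^ 2 ∂seqLaw ν = s * (seqLaw ν).real D := by
    rw [← integral_indicator hD]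
    have := i2.integral_fun_mul_eq_mul_integral
      (measurable_const.indicator hD).aestronglyMeasurable
      ((measurable_pi_apply _).pow_const 2).aestronglyMeasurable
    rw [hm2, integral_indicator_const _ hD, smul_eq_mul, mul_one, mul_comm] at this
    rw [← this]
    congr 1 with W
    by_cases h : W ∈ D
    · simp [h]
    · simp [h]
  have j1 := (integrable_drift_sq h2 a n).integrableOn (s := D)
  have j2 : IntegrableOn (fun W => drift a W n * W (n + 1)) D (seqLaw ν) :=
    ((memLp_drift h2 a n).integrable_mul hmem).integrableOn
  have j3 : IntegrableOn (fun W : ℕ → ℝ => W (n + 1) ^ 2) D (seqLaw ν) :=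
    hmem.integrable_sq.integrableOn
  have e : ∀ W : ℕ → ℝ, drift a W (n + 1) ^ 2
      = a ^ 2 * drift a W n ^ 2 + 2 * a * (drift a W n * W (n + 1)) + W (n + 1) ^ 2 := fun W => by
    rw [drift]
    ring
  have j4 : IntegrableOn (fun W => a ^ 2 * drift a W n ^ 2 + 2 * a * (drift a W n * W (n + 1))) D
      (seqLaw ν) := (j1.const_mul _).add (j2.const_mul _)
  simp only [e]
  rw [integral_add j4 j3, integral_add (j1.const_mul _) (j2.const_mul _), integral_const_mul, integral_const_mul, c1, c2]
  ring

lemma measurePreserving_neg_seqLaw (hneg : ν.map (fun x => -x) = ν) :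
    MeasurePreserving (fun W : ℕ → ℝ => -W) (seqLaw ν) (seqLaw ν) := by
  refine ⟨measurable_neg, ?_⟩
  have := Measure.infinitePi_map_pi (μ := fun _ : ℕ => ν) (f := fun _ x => -x)
    fun _ => measurable_neg
  simp only [hneg] at this
  exact this

/-- A symmetric noise leaves the plant state centered on every symmetric event. -/
lemma setIntegral_drift_eq_zero (hneg : ν.map (fun x => -x) = ν) {D : Set (ℕ → ℝ)}
    (hsym : ∀ W, -W ∈ D ↔ W ∈ D) (n : ℕ) :
    ∫ W in D, drift a W n ∂seqLaw ν = 0 := by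
  have h := (measurePreserving_neg_seqLaw hneg).setIntegral_preimage_emb
    (MeasurableEquiv.neg (ℕ → ℝ)).measurableEmbedding (fun W => drift a W n) D
  have hpre : (fun W : ℕ → ℝ => -W) ⁻¹' D = D := Set.ext hsym
  rw [hpre] at h
  simp only [drift_neg, integral_neg] at h
  linarith

/-- The discounted sum of the solution of a stable affine recursion. -/
lemma hasSum_geometric_affine {v : ℕ → ℝ} {q p c : ℝ} (hp0 : 0 ≤ p) (hp1 : p < 1)
    (hpq : p * q < 1) (hv0 : ∀ m, 0 ≤ v m) (hc : 0 ≤ c)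
    (hv : ∀ m, v (m + 1) = q * v m + c) :
    HasSum (fun m => p ^ m * v m) ((v 0 + p * c / (1 - p)) / (1 - p * q)) := by
  have h1 : 0 < 1 - p * q := by linarith
  have h2 : 0 < 1 - p := by linarith
  have hf0 : ∀ m, 0 ≤ p ^ m * v m := fun m => mul_nonneg (pow_nonneg hp0 m) (hv0 m)
  -- Multiplying the recursion by `p ^ (m + 1)` and summing gives a linear equation for the partial
  -- sum.
  have key : ∀ M, ∑ m ∈ Finset.range M, p ^ m * v m
      = (v 0 - p ^ M * v M + p * c * (1 - p ^ M) / (1 - p)) / (1 - p * q) := by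
    intro M
    induction M with
    | zero => simp
    | succ M ih =>
      rw [Finset.sum_range_succ, ih, hv M]
      field_simp
      ring
  -- Dropping `- p ^ M * v M ≤ 0` bounds the partial sums. Summability in turn yields `p ^ M * v M →
  -- 0`, so no growth estimate for `v` is needed.
  have hsummable : Summable fun m => p ^ m * v m := by
    refine summable_of_sum_range_le hf0 (c := (v 0 + p * c / (1 - p)) / (1 - p * q)) fun M => ?_
    rw [key M]
    have h3 := hf0 M
    have h4 : p * c * (1 - p ^ M) ≤ p * c := by
      have := mul_nonneg (mul_nonneg hp0 hc) (pow_nonneg hp0 M)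
      linarith
    have h5 : p * c * (1 - p ^ M) / (1 - p) ≤ p * c / (1 - p) := by gcongr
    gcongr
    linarith
  have ht := hsummable.tendsto_atTop_zero
  refine (hasSum_iff_tendsto_nat_of_nonneg hf0 _).2 ?_
  simp only [key]
  have hpow := tendsto_pow_atTop_nhds_zero_of_lt_one hp0 hp1
  have : (v 0 + p * c / (1 - p)) / (1 - p * q)
      = (v 0 - 0 + p * c * (1 - 0) / (1 - p)) / (1 - p * q) := by ring
  rw [this]
  exact (((tendsto_const_nhds.sub ht).add
    ((tendsto_const_nhds.mul (tendsto_const_nhds.sub hpow)).div_const _)).div_const _)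

end Moments

/-! ### Expected costs per cycle as real numbers -/

section Cycle

variable {a b K ε : ℝ} {T : ℕ}

/-- A cost that depends on the plant state and on whether a packet is received. -/
noncomputable def weightedCost (c₀ c₁ : ℝ) (g : ℝ → ℝ) (s : LoopState) : ℝ :=
  (if s.2 = (0, 0) then c₀ else c₁) * g s.1

lemma measurable_weightedCost (c₀ c₁ : ℝ) {g : ℝ → ℝ} (hg : Measurable g) :
    Measurable (weightedCost c₀ c₁ g) := by
  refine Measurable.mul ?_ (hg.comp measurable_fst)
  exact Measurable.ite (measurable_snd (measurableSet_singleton _)) measurable_const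
    measurable_const

lemma weightedCost_nonneg {c₀ c₁ : ℝ} (h₀ : 0 ≤ c₀) (h₁ : 0 ≤ c₁) {g : ℝ → ℝ}
    (hg : ∀ x, 0 ≤ g x) (s : LoopState) : 0 ≤ weightedCost c₀ c₁ g s := by
  unfold weightedCost
  split_ifs
  · exact mul_nonneg h₀ (hg _)
  · exact mul_nonneg h₁ (hg _)

/-- The total cost of a cycle. -/
noncomputable def cycleCost (a b K ε : ℝ) (T : ℕ) (c : LoopState → ℝ) (z : ℕ → ℝ × Bool) : ℝ :=
  ∑ k ∈ Finset.range (cycleLength a b K ε T z), c (loop a b K ε T (0, 0, 0) z (k + 1))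

lemma measurable_cycleCost {c : LoopState → ℝ} (hc : Measurable c) :
    Measurable (cycleCost a b K ε T c) := by
  have : Measurable fun q : ℕ × (ℕ → ℝ × Bool) =>
      ∑ k ∈ Finset.range q.1, c (loop a b K ε T (0, 0, 0) q.2 (k + 1)) :=
    measurable_from_prod_countable_right fun n =>
      Finset.measurable_fun_sum (Finset.range n) fun k _ =>
        hc.comp (measurable_loop (0, 0, 0) (k + 1))
  exact this.comp (measurable_cycleLength.prodMk measurable_id)

/-- The total cost of a cycle is integrable, with an explicit mean. -/
lemma integral_cycleCost {μ : Measure (ℕ → ℝ × Bool)} [IsProbabilityMeasure μ] {p : ℝ}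
    (hp0 : 0 ≤ p) (hp1 : p < 1) (hpos : ∀ᵐ z ∂μ, 0 < cycleLength a b K ε T z)
    (hind : IndepFun noise losses μ)
    (hlost : ∀ i m, μ.map losses (lostSet i (i + m)) = ENNReal.ofReal p ^ m)
    (hlostU : ∀ i m, μ.map losses (lostUntilSet i (i + m))
      = ENNReal.ofReal p ^ m * (1 - ENNReal.ofReal p))
    {g : ℝ → ℝ} (hg : Measurable g) (hg0 : ∀ x, 0 ≤ g x)
    (hgi : ∀ k, Integrable (fun W => g (drift a W k)) (μ.map noise))
    {c₀ c₁ : ℝ} (h₀ : 0 ≤ c₀) (h₁ : 0 ≤ c₁) {H : ℕ → ℝ}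
    (hH : ∀ i, HasSum (fun m => p ^ m * ∫ W in attemptSet a ε T i, g (drift a W (i + m))
      ∂μ.map noise) (H i)) :
    Integrable (cycleCost a b K ε T (weightedCost c₀ c₁ g)) μ ∧
      ∫ z, cycleCost a b K ε T (weightedCost c₀ c₁ g) z ∂μ
        = c₁ * ∑ k ∈ Finset.range T, ∫ W in quietSet a ε (k + 1), g (drift a W k) ∂μ.map noise
          + (c₁ * p + c₀ * (1 - p)) * ∑ i ∈ Finset.range (T + 1), H i := by
  have hcm := measurable_weightedCost c₀ c₁ hg
  have hc0 := weightedCost_nonneg h₀ h₁ hg0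
  have hR0 : ∀ z, 0 ≤ cycleCost a b K ε T (weightedCost c₀ c₁ g) z :=
    fun z => Finset.sum_nonneg fun k _ => hc0 _
  have hset : ∀ (D : Set (ℕ → ℝ)) (k : ℕ) (c : ℝ), 0 ≤ c →
      ∫⁻ W in D, ENNReal.ofReal (c * g (drift a W k)) ∂μ.map noise
        = ENNReal.ofReal (c * ∫ W in D, g (drift a W k) ∂μ.map noise) := by
    intro D k c hc
    rw [← integral_const_mul, ofReal_integral_eq_lintegral_ofReal]
    · exact ((hgi k).const_mul c).integrableOn
    · exact ae_of_all _ fun W => mul_nonneg hc (hg0 _)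
  have hI0 : ∀ (D : Set (ℕ → ℝ)) (k : ℕ), 0 ≤ ∫ W in D, g (drift a W k) ∂μ.map noise :=
    fun D k => integral_nonneg fun W => hg0 _
  have hH0 : ∀ i, 0 ≤ H i := fun i => (hH i).nonneg fun m => mul_nonneg (pow_nonneg hp0 m) (hI0 _ _)
  have hp1' : 0 ≤ 1 - p := by linarith
  have hw0 : 0 ≤ c₁ * p + c₀ * (1 - p) := by positivity
  -- A state after `m` losses is weighted by `p ^ m * (p * c₁ + (1 - p) * c₀)`: the attempt
  -- producing it is lost or succeeds.
  have hinner : ∀ i, ∑' m,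
      (ENNReal.ofReal p ^ (m + 1) * ∫⁻ W in attemptSet a ε T i,
          ENNReal.ofReal (c₁ * g (drift a W (i + m))) ∂μ.map noise
        + ENNReal.ofReal p ^ m * (1 - ENNReal.ofReal p) * ∫⁻ W in attemptSet a ε T i,
          ENNReal.ofReal (c₀ * g (drift a W (i + m))) ∂μ.map noise)
      = ENNReal.ofReal ((c₁ * p + c₀ * (1 - p)) * H i) := by
    intro i
    have hs := (hH i).mul_left (c₁ * p + c₀ * (1 - p))
    rw [← hs.tsum_eq, ENNReal.ofReal_tsum_of_nonneg _ hs.summable]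
    · refine tsum_congr fun m => ?_
      have hI := hI0 (attemptSet a ε T i) (i + m)
      rw [hset _ _ _ h₁, hset _ _ _ h₀, ← ENNReal.ofReal_one, ← ENNReal.ofReal_sub _ hp0,
        ← ENNReal.ofReal_pow hp0, ← ENNReal.ofReal_pow hp0, ← ENNReal.ofReal_mul (by positivity),
        ← ENNReal.ofReal_mul (by positivity), ← ENNReal.ofReal_mul (by positivity),
        ← ENNReal.ofReal_add (by positivity) (by positivity)]
      congr 1
      ring
    · exact fun m => mul_nonneg hw0 (mul_nonneg (pow_nonneg hp0 m) (hI0 _ _))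
  have hL : ∫⁻ z, ENNReal.ofReal (cycleCost a b K ε T (weightedCost c₀ c₁ g) z) ∂μ
      = ENNReal.ofReal
        (c₁ * ∑ k ∈ Finset.range T, ∫ W in quietSet a ε (k + 1), g (drift a W k) ∂μ.map noise
          + (c₁ * p + c₀ * (1 - p)) * ∑ i ∈ Finset.range (T + 1), H i) := by
    have h := tsum_lintegral_alive (a := a) (b := b) (K := K) (ε := ε) (T := T) hind hlost hlostU
      (g₀ := fun x => ENNReal.ofReal (c₀ * g x)) (g₁ := fun x => ENNReal.ofReal (c₁ * g x))
      (hg.const_mul c₀).ennreal_ofReal (hg.const_mul c₁).ennreal_ofReal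
    simp only [hinner] at h
    simp only [hset _ _ _ h₁] at h
    rw [← lintegral_tsum] at h
    · rw [ENNReal.ofReal_add, Finset.mul_sum, Finset.mul_sum, ENNReal.ofReal_sum_of_nonneg,
        ENNReal.ofReal_sum_of_nonneg, ← h]
      · refine lintegral_congr_ae ?_
        filter_upwards [hpos] with z hz
        rw [cycleCost, ENNReal.ofReal_sum_of_nonneg fun k _ => hc0 _,
          tsum_eq_sum (s := Finset.range (cycleLength a b K ε T z))]
        · refine Finset.sum_congr rfl fun k hk => ?_
          rw [Set.indicator_of_mem
            ((alive_iff_lt_cycleLength hz k).2 (Finset.mem_range.1 hk)), weightedCost]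
          split_ifs <;> rfl
        · intro k hk
          exact Set.indicator_of_notMem (fun h => hk (Finset.mem_range.2
            ((alive_iff_lt_cycleLength hz k).1 h))) _
      · exact fun i _ => mul_nonneg hw0 (hH0 i)
      · exact fun k _ => mul_nonneg h₁ (hI0 _ _)
      · exact mul_nonneg h₁ (Finset.sum_nonneg fun k _ => hI0 _ _)
      · exact mul_nonneg hw0 (Finset.sum_nonneg fun i _ => hH0 i)
    · intro k
      refine Measurable.aemeasurable (Measurable.indicator ?_ (measurableSet_alive k))
      have hl := measurable_loop (a := a) (b := b) (K := K) (ε := ε) (T := T) (0, 0, 0) (k + 1)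
      exact Measurable.ite (hl.snd (measurableSet_singleton _))
        ((hg.const_mul c₀).ennreal_ofReal.comp hl.fst)
        ((hg.const_mul c₁).ennreal_ofReal.comp hl.fst)
  have hRm := measurable_cycleCost (a := a) (b := b) (K := K) (ε := ε) (T := T) hcm
  refine ⟨⟨hRm.aestronglyMeasurable, ?_⟩, ?_⟩
  · rw [hasFiniteIntegral_iff_ofReal (ae_of_all _ hR0), hL]
    exact ENNReal.ofReal_lt_top
  · rw [integral_eq_lintegral_of_nonneg_ae (ae_of_all _ hR0) hRm.aestronglyMeasurable, hL,
      ENNReal.toReal_ofReal]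
    exact add_nonneg (mul_nonneg h₁ (Finset.sum_nonneg fun k _ => hI0 _ _))
      (mul_nonneg hw0 (Finset.sum_nonneg fun i _ => hH0 i))

end Cycle

/-! ### Time averages of the loop -/

section Average

variable {a b K ε : ℝ} {T : ℕ} {ν : Measure (ℝ × Bool)} [IsProbabilityMeasure ν]

/-- All shifts are needed at once, because the first reception time varies with `z` and with the
initial state. -/
lemma ae_shiftSeq {q : (ℕ → ℝ × Bool) → Prop} (h : ∀ᵐ z ∂seqLaw ν, q z) :
    ∀ᵐ z ∂seqLaw ν, ∀ n, q (shiftSeq n z) := by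
  refine ae_all_iff.2 fun n => ?_
  have h3 := map_shiftSeq_eq_seqLaw (ν := ν) (fun k => measurable_pi_apply k)
    (iIndepFun_seqLaw ν) (fun k => Measure.infinitePi_map_eval _ k) n
  rw [← h3] at h
  exact ae_of_ae_map (measurable_shiftSeq n).aemeasurable h

/-- Almost surely, there are `T + 1` consecutive samples without a loss. -/
lemma ae_exists_no_loss (hν : ν {q | q.2 = false} ≠ 0) (T : ℕ) :
    ∀ᵐ z ∂seqLaw ν, ∃ n, ∀ k ≤ T, (shiftSeq n z k).2 = false := by
  set G : Set (ℕ → ℝ × Bool) := {z | ∀ k ≤ T, (z k).2 = false} with hG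
  set A : Set (ℕ → ℝ × Bool) := {z | ∀ n, shiftSeq n z ∉ G} with hA
  have hGeq : G = (Finset.range (T + 1) : Set ℕ).pi fun _ => {q : ℝ × Bool | q.2 = false} := by
    ext z
    simp [hG]
  have mF : MeasurableSet {q : ℝ × Bool | q.2 = false} :=
    measurable_snd (measurableSet_singleton false)
  have mG : MeasurableSet G := by
    rw [hGeq]
    exact MeasurableSet.pi (Set.to_countable _) fun _ _ => mF
  have mA : MeasurableSet A := by
    have : A = ⋂ n, (shiftSeq n ⁻¹' G)ᶜ := by
      ext z
      simp [hA]
    rw [this]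
    exact MeasurableSet.iInter fun n => (measurable_shiftSeq n mG).compl
  have hGpos : seqLaw ν G ≠ 0 := by
    rw [hGeq, Measure.infinitePi_pi _ fun _ _ => mF]
    exact Finset.prod_ne_zero_iff.2 fun _ _ => hν
  -- Failure for ever means failure in the first block and failure for ever afterwards. By
  -- independence the probability of `A` is at most itself times a factor below `1`, hence zero.
  have hsub : A ⊆ Gᶜ ∩ shiftSeq (T + 1) ⁻¹' A := by
    intro z hz
    refine ⟨hz 0 ∘ fun h => ?_, fun n => ?_⟩
    · have : shiftSeq 0 z = z := funext fun k => by simp [shiftSeq]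
      rwa [this]
    · have : shiftSeq n (shiftSeq (T + 1) z) = shiftSeq (T + 1 + n) z :=
        funext fun k => by simp [shiftSeq, add_assoc]
      rw [this]
      exact hz _
  have hle : seqLaw ν A ≤ seqLaw ν Gᶜ * seqLaw ν A := by
    rw [← seqLaw_inter_trunc_shift (0, false) (T + 1) mG.compl mA]
    · exact measure_mono hsub
    · intro z
      refine not_congr (forall₂_congr fun k hk => ?_)
      rw [truncSeq_of_lt _ _ (Nat.lt_succ_of_le hk)]
  have hlt : seqLaw ν Gᶜ < 1 := by
    rw [prob_compl_eq_one_sub mG]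
    exact ENNReal.sub_lt_self ENNReal.one_ne_top one_ne_zero hGpos
  have hA0 : seqLaw ν A = 0 := by
    by_contra h0
    have := ENNReal.mul_lt_mul_left h0 (measure_ne_top _ _) hlt
    rw [one_mul] at this
    exact absurd hle (not_le.2 this)
  rw [ae_iff]
  have hsub' : {z : ℕ → ℝ × Bool | ¬∃ n, ∀ k ≤ T, (shiftSeq n z k).2 = false} ⊆ A :=
    fun z hz n hn => hz ⟨n, hn⟩
  exact measure_mono_null hsub' hA0

/-- A loss-free block forces a reception from any state, so the exceptional null set does not depend
on `s`. -/
lemma ae_exists_reset (hν : ν {q | q.2 = false} ≠ 0) :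
    ∀ᵐ z ∂seqLaw ν, ∀ s, ∃ k, (loop a b K ε T s z (k + 1)).2 = (0, 0) := by
  filter_upwards [ae_exists_no_loss hν T] with z ⟨n, hn⟩ s
  obtain ⟨k, -, hk⟩ := exists_reset_of_no_loss (a := a) (b := b) (K := K) (ε := ε)
    (loop a b K ε T s z n) hn
  refine ⟨n + k, ?_⟩
  rw [add_assoc, loop_add]
  exact hk

lemma ae_cycleLength_pos (hν : ν {q | q.2 = false} ≠ 0) :
    ∀ᵐ z ∂seqLaw ν, 0 < cycleLength a b K ε T z := by
  filter_upwards [ae_exists_reset hν] with z hz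
  exact cycleLength_pos_iff.2 (hz _)

lemma tendsto_average_add {B : ℕ → ℝ} {l : ℝ} (hB : Tendsto (fun N : ℕ => B N / N) atTop (𝓝 l))
    (C : ℝ) (m : ℕ) :
    Tendsto (fun N : ℕ => (C + B N) / ((N + m : ℕ) : ℝ)) atTop (𝓝 l) := by
  have h1 : Tendsto (fun N : ℕ => (N : ℝ) / (N + m)) atTop (𝓝 1) :=
    tendsto_natCast_div_add_atTop (m : ℝ)
  have h2 : Tendsto (fun N : ℕ => C / (N : ℝ)) atTop (𝓝 0) := tendsto_const_div_atTop_nhds_zero_nat C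
  have h := (h2.add hB).mul h1
  rw [zero_add, mul_one] at h
  refine h.congr' ?_
  filter_upwards [eventually_gt_atTop 0] with N hN
  have : (0 : ℝ) < N := by positivity
  push_cast
  field_simp

/-- The long-run average of a cost is the mean cost per cycle over the mean length of a cycle,
whatever the initial state. -/
theorem ae_tendsto_average_loop (hK : a + b * K = 0) (hν : ν {q | q.2 = false} ≠ 0)
    {c : LoopState → ℝ} (hc : Measurable c) (hc0 : ∀ s, 0 ≤ c s)
    (hτi : Integrable (fun z => (cycleLength a b K ε T z : ℝ)) (seqLaw ν))
    (hRi : Integrable (cycleCost a b K ε T c) (seqLaw ν)) :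
    ∀ᵐ z ∂seqLaw ν, ∀ s, Tendsto
      (fun N : ℕ => (∑ k ∈ Finset.range N, c (loop a b K ε T s z k)) / N) atTop
      (𝓝 ((∫ z, cycleCost a b K ε T c z ∂seqLaw ν)
        / ∫ z, (cycleLength a b K ε T z : ℝ) ∂seqLaw ν)) := by
  have hren := tendsto_average_of_renewal (ν := ν) (measurable_cycleLength (a := a) (b := b)
    (K := K) (ε := ε) (T := T)) (ae_cycleLength_pos hν)
    (C := fun z k => c (loop a b K ε T (0, 0, 0) z (k + 1))) (fun _ _ => hc0 _)
    (measurable_cycleCost hc)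
    (fun z z' h1 h2 => ⟨(cycle_congr h1 h2).1, fun k hk => by rw [(cycle_congr h1 h2).2 k hk]⟩)
    (fun z h k => by rw [loop_cycleLength_add hK h]) hτi hRi
  filter_upwards [ae_shiftSeq hren, ae_exists_reset (a := a) (b := b) (K := K) (ε := ε) (T := T) hν]
    with z hz hr s
  obtain ⟨k, hk⟩ := hr s
  -- The `k + 2` terms at the times `0, …, k + 1`, up to and including a reception, form the
  -- negligible head.
  have h := tendsto_average_add (hz (k + 1))
    (∑ j ∈ Finset.range (k + 1 + 1), c (loop a b K ε T s z j)) (k + 1 + 1)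
  refine (tendsto_add_atTop_iff_nat (f := fun N : ℕ =>
    (∑ k ∈ Finset.range N, c (loop a b K ε T s z k)) / (N : ℝ)) (k + 1 + 1)).1 ?_
  refine h.congr fun N => ?_
  have e : ∀ j, loop a b K ε T s z (k + 1 + 1 + j)
      = loop a b K ε T (0, 0, 0) (shiftSeq (k + 1) z) (j + 1) := fun j => by
    rw [show k + 1 + 1 + j = k + 1 + (j + 1) by ring, loop_add, loop_of_reset hK hk]
  simp only [add_comm N, Finset.sum_range_add, e]

end Average

/-! ### The joint law of the noise and the channel -/

section JointLaw

variable {Ω : Type*} [MeasurableSpace Ω] {P : Measure Ω}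

/-- Two independent sequences of independent variables form an independent sequence of pairs. -/
lemma iIndepFun_pair {E F : Type*} [MeasurableSpace E] [MeasurableSpace F]
    {X : ℕ → Ω → E} {Y : ℕ → Ω → F} (hX : ∀ k, Measurable (X k)) (hY : ∀ k, Measurable (Y k))
    (hXi : iIndepFun X P) (hYi : iIndepFun Y P)
    (hXY : IndepFun (fun ω k => X k ω) (fun ω k => Y k ω) P) :
    iIndepFun (fun k ω => (X k ω, Y k ω)) P := by
  set R : Set (Set (E × F)) :=
    Set.image2 (· ×ˢ ·) {s : Set E | MeasurableSet s} {t : Set F | MeasurableSet t} with hR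
  rw [iIndepFun_iff_iIndep]
  -- Measurable rectangles are a generating π-system, and on them the events split into an `X` part
  -- and a `Y` part.
  refine iIndepSets.iIndep (fun k => ((hX k).prodMk (hY k)).comap_le)
    (fun k => Set.preimage (fun ω => (X k ω, Y k ω)) '' R)
    (fun k => ?_) (fun k => ?_) ?_
  · have := (isPiSystem_prod (α := E) (β := F)).comap fun ω => (X k ω, Y k ω)
    exact this
  · rw [← MeasurableSpace.comap_generateFrom, hR, generateFrom_prod]
  · rw [iIndepSets_iff]
    intro S f hf
    have hf' : ∀ i, ∃ A : Set E, ∃ B : Set F, MeasurableSet A ∧ MeasurableSet B ∧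
        (i ∈ S → f i = X i ⁻¹' A ∩ Y i ⁻¹' B) := by
      intro i
      by_cases hi : i ∈ S
      · obtain ⟨_, ⟨A, hA, B, hB, rfl⟩, hfi⟩ := hf i hi
        exact ⟨A, B, hA, hB, fun _ => hfi.symm⟩
      · exact ⟨∅, ∅, .empty, .empty, fun h => absurd h hi⟩
    choose A B hA hB hfi using hf'
    have hAi := (iIndepFun_iff_measure_inter_preimage_eq_mul.1 hXi) S (sets := A) fun i _ => hA i
    have hBi := (iIndepFun_iff_measure_inter_preimage_eq_mul.1 hYi) S (sets := B) fun i _ => hB i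
    have hprod : ∀ S : Finset ℕ, P ((⋂ i ∈ S, X i ⁻¹' A i) ∩ ⋂ i ∈ S, Y i ⁻¹' B i)
        = P (⋂ i ∈ S, X i ⁻¹' A i) * P (⋂ i ∈ S, Y i ⁻¹' B i) := by
      intro S
      have h := hXY.measure_inter_preimage_eq_mul (⋂ i ∈ S, (fun x : ℕ → E => x i) ⁻¹' A i)
        (⋂ i ∈ S, (fun y : ℕ → F => y i) ⁻¹' B i)
        (Finset.measurableSet_biInter _ fun i _ => measurable_pi_apply i (hA i))
        (Finset.measurableSet_biInter _ fun i _ => measurable_pi_apply i (hB i))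
      simpa only [Set.preimage_iInter, Set.preimage_preimage] using h
    have e1 : ⋂ i ∈ S, f i = (⋂ i ∈ S, X i ⁻¹' A i) ∩ ⋂ i ∈ S, Y i ⁻¹' B i := by
      rw [Set.iInter₂_congr hfi]
      ext ω
      simp only [Set.mem_iInter, Set.mem_inter_iff]
      exact forall₂_and
    have e2 : ∀ i ∈ S, P (f i) = P (X i ⁻¹' A i) * P (Y i ⁻¹' B i) := by
      intro i hi
      have := hprod {i}
      simp only [Finset.mem_singleton, Set.iInter_iInter_eq_left] at this
      rw [hfi i hi, this]
    rw [e1, hprod, hAi, hBi, ← Finset.prod_mul_distrib]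
    exact Finset.prod_congr rfl fun i hi => (e2 i hi).symm

variable {L : ℕ → Ω → Bool} {p : ℝ}

lemma measure_lostSet (hL : ∀ k, Measurable (L k)) (hLi : iIndepFun L P)
    (hLp : ∀ k, P {ω | L k ω = true} = ENNReal.ofReal p) (i m : ℕ) :
    P.map (fun ω k => L k ω) (lostSet i (i + m)) = ENNReal.ofReal p ^ m := by
  rw [Measure.map_apply (measurable_pi_iff.2 hL) (measurableSet_lostSet i _)]
  have h := (iIndepFun_iff_measure_inter_preimage_eq_mul.1 hLi) (Finset.Ico i (i + m))
    (sets := fun _ => {true}) fun _ _ => measurableSet_singleton _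
  have e : ∀ k, L k ⁻¹' {true} = {ω | L k ω = true} := fun k => rfl
  simp only [e, hLp, Finset.prod_const, Nat.card_Ico, Nat.add_sub_cancel_left] at h
  rw [← h]
  congr 1
  ext ω
  simp [lostSet]

lemma measure_lostUntilSet [IsProbabilityMeasure P] (hL : ∀ k, Measurable (L k)) (hLi : iIndepFun L P)
    (hLp : ∀ k, P {ω | L k ω = true} = ENNReal.ofReal p) (i m : ℕ) :
    P.map (fun ω k => L k ω) (lostUntilSet i (i + m))
      = ENNReal.ofReal p ^ m * (1 - ENNReal.ofReal p) := by
  -- This gives the probability as `p ^ m - p ^ (m + 1)`.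
  have hd : lostUntilSet i (i + m) = lostSet i (i + m) \ lostSet i (i + (m + 1)) := by
    ext l
    constructor
    · rintro ⟨h1, h2⟩
      refine ⟨h1, fun h => ?_⟩
      have h3 : l (i + m) = false := h2
      rw [h (i + m) (by omega) (by omega)] at h3
      simp at h3
    · rintro ⟨h1, h2⟩
      refine ⟨h1, ?_⟩
      by_contra hc
      refine h2 fun j h3 h4 => ?_
      rcases Nat.lt_succ_iff_lt_or_eq.1 h4 with h | rfl
      · exact h1 j h3 h
      · simpa using hc
  have hsub : lostSet i (i + (m + 1)) ⊆ lostSet i (i + m) :=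
    fun l h j h1 h2 => h j h1 (by omega)
  have : IsProbabilityMeasure (P.map fun ω k => L k ω) :=
    Measure.isProbabilityMeasure_map (measurable_pi_iff.2 hL).aemeasurable
  rw [hd, measure_sdiff hsub (measurableSet_lostSet _ _).nullMeasurableSet (measure_ne_top _ _),
    measure_lostSet hL hLi hLp, measure_lostSet hL hLi hLp,
    ENNReal.mul_sub fun _ _ => ENNReal.pow_ne_top ENNReal.ofReal_ne_top, mul_one, pow_succ]

lemma map_bool_eq [IsProbabilityMeasure P] {f g : Ω → Bool} (hf : Measurable f) (hg : Measurable g)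
    (h : P {ω | f ω = true} = P {ω | g ω = true}) : P.map f = P.map g := by
  have e : ∀ f : Ω → Bool, f ⁻¹' {false} = {ω | f ω = true}ᶜ := fun f => by
    ext ω
    simp
  have hm : ∀ {f : Ω → Bool}, Measurable f → MeasurableSet {ω | f ω = true} :=
    fun hf => hf (measurableSet_singleton true)
  refine Measure.ext_of_singleton fun x => ?_
  rw [Measure.map_apply hf (measurableSet_singleton x),
    Measure.map_apply hg (measurableSet_singleton x)]
  cases x
  · rw [e, e, prob_compl_eq_one_sub (hm hf), prob_compl_eq_one_sub (hm hg), h]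
  · exact h

end JointLaw

/-! ### The invariant distribution of `(r, γ)` -/

section Chain

variable {p : ℝ} {q : ℕ → ℝ} {T : ℕ}

/-- Telescoping. With `N = T + 1` and `q T = 1` the right side is `1`: a first attempt surely
occurs. -/
lemma sum_mul_prod_one_sub (q : ℕ → ℝ) (N : ℕ) :
    ∑ n ∈ Finset.range N, q n * ∏ m ∈ Finset.range n, (1 - q m)
      = 1 - ∏ m ∈ Finset.range N, (1 - q m) := by
  induction N with
  | zero => simp
  | succ N ih =>
    rw [Finset.sum_range_succ, ih, Finset.prod_range_succ]
    ring

/-- The invariant measure of the chain, normalized to the value `1` at `(0, 0)`. -/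
noncomputable def chainMass (p : ℝ) (q : ℕ → ℝ) (T : ℕ) (s : Fin (T + 1) × ℕ) : ℝ :=
  (∏ m ∈ Finset.range s.1, (1 - q m)) * if s.2 = 0 then 1 else q s.1 * p ^ s.2

/-- The total mass of `chainMass`. -/
noncomputable def chainTotal (p : ℝ) (q : ℕ → ℝ) (T : ℕ) : ℝ :=
  ∑ n ∈ Finset.range (T + 1), Theta p q n * ∏ m ∈ Finset.range n, (1 - q m)

lemma chainMass_row (i : Fin (T + 1)) :
    chainMass p q T (i, 0) = ∏ m ∈ Finset.range i, (1 - q m) := by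
  simp [chainMass]

lemma chainMass_succ (i : Fin (T + 1)) (j : ℕ) : chainMass p q T (i, j + 1)
    = chainMass p q T (i, j) * (p * attemptProb q i j) := by
  cases j with
  | zero =>
    simp only [chainMass, attemptProb, if_true, zero_add, one_ne_zero, if_false, pow_one]
    ring
  | succ j =>
    simp only [chainMass, attemptProb, Nat.succ_ne_zero, if_false, pow_succ]
    ring

lemma chainTotal_eq (p : ℝ) (q : ℕ → ℝ) (T : ℕ) : chainTotal p q T
    = Theta p q 0 + ∑ n ∈ Finset.Icc 1 T, Theta p q n * ∏ m ∈ Finset.range n, (1 - q m) := by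
  rw [chainTotal, Finset.sum_range_eq_add_Ico _ (Nat.succ_pos T), Finset.prod_range_zero, mul_one]
  rfl

lemma hasSum_prod_of_hasSum {ι : Type*} [Fintype ι] {f : ι × ℕ → ℝ} {g : ι → ℝ}
    (hf : ∀ s, 0 ≤ f s) (h : ∀ i, HasSum (fun j => f (i, j)) (g i)) : HasSum f (∑ i, g i) := by
  have hs : Summable f := (summable_prod_of_nonneg hf).2
    ⟨fun i => (h i).summable, (hasSum_fintype _).summable⟩
  have := hs.hasSum.prod_fiberwise h
  rw [(hasSum_fintype g).unique this]
  exact hs.hasSum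

lemma transition_zero (s : Fin (T + 1) × ℕ) :
    transition p q T s (0, 0) = (1 - p) * attemptProb q s.1 s.2 := by
  simp [transition, Prod.ext_iff]

/-- The only state leading to `(i, j + 1)` is `(i, j)`. Similarly, below, only `(i, 0)` leads to `(i
+ 1, 0)`. -/
lemma hasSum_mul_transition_succ (f : Fin (T + 1) × ℕ → ℝ) (i : Fin (T + 1)) (j : ℕ) :
    HasSum (fun s => f s * transition p q T s (i, j + 1))
      (f (i, j) * (p * attemptProb q i j)) := by
  have h : transition p q T (i, j) (i, j + 1) = p * attemptProb q i j := by
    simp [transition]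
  rw [← h]
  refine hasSum_single (i, j) fun s hs => ?_
  have : ¬ (i = s.1 ∧ j = s.2) := fun h => hs (Prod.ext h.1.symm h.2.symm)
  simp [transition, this]

lemma hasSum_mul_transition_quiet (f : Fin (T + 1) × ℕ → ℝ) {i : ℕ} (hi : i < T) :
    HasSum (fun s => f s * transition p q T s (⟨i + 1, by omega⟩, 0))
      (f (⟨i, by omega⟩, 0) * (1 - q i)) := by
  have h : transition p q T ((⟨i, by omega⟩ : Fin (T + 1)), 0)
      ((⟨i + 1, by omega⟩ : Fin (T + 1)), 0) = 1 - q i := by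
    simp [transition, attemptProb, Fin.ext_iff]
  rw [← h]
  refine hasSum_single ((⟨i, by omega⟩ : Fin (T + 1)), 0) fun s hs => ?_
  obtain ⟨⟨k, hk⟩, j⟩ := s
  by_cases hj : j = 0
  · subst hj
    have : ¬ i = k := fun h => hs (by simp [h])
    simp [transition, this, Fin.ext_iff]
  · simp [transition, attemptProb, hj, Fin.ext_iff]

lemma Theta_pos (hp0 : 0 < p) (hp1 : p < 1) {n : ℕ} (hq : 0 ≤ q n) : 0 < Theta p q n := by
  refine div_pos ?_ (by linarith)
  nlinarith

lemma chainTotal_pos (hp0 : 0 < p) (hp1 : p < 1) (hq0 : ∀ i, 0 ≤ q i) (hq1 : ∀ i, q i ≤ 1) :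
    0 < chainTotal p q T := by
  rw [chainTotal_eq]
  refine add_pos_of_pos_of_nonneg (Theta_pos hp0 hp1 (hq0 0)) (Finset.sum_nonneg fun n _ => ?_)
  exact mul_nonneg (Theta_pos hp0 hp1 (hq0 n)).le
    (Finset.prod_nonneg fun m _ => sub_nonneg.2 (hq1 m))

lemma chainMass_nonneg (hp0 : 0 < p) (hq0 : ∀ i, 0 ≤ q i) (hq1 : ∀ i, q i ≤ 1)
    (s : Fin (T + 1) × ℕ) : 0 ≤ chainMass p q T s := by
  refine mul_nonneg (Finset.prod_nonneg fun m _ => sub_nonneg.2 (hq1 m)) ?_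
  split_ifs
  · exact zero_le_one
  · exact mul_nonneg (hq0 _) (pow_nonneg hp0.le _)

/-- A geometric series with its first term replaced. -/
lemma hasSum_ite_geometric (hp0 : 0 < p) (hp1 : p < 1) (A B : ℝ) :
    HasSum (fun j : ℕ => if j = 0 then A else B * p ^ j) (A + B * p / (1 - p)) := by
  have h := (hasSum_geometric_of_lt_one hp0.le hp1).mul_left (B * p)
  rw [← div_eq_mul_inv] at h
  have h' : HasSum (fun j : ℕ => if j + 1 = 0 then A else B * p ^ (j + 1)) (B * p / (1 - p)) := by
    have e : (fun j : ℕ => if j + 1 = 0 then A else B * p ^ (j + 1)) = fun j => B * p * p ^ j :=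
      funext fun j => by
        rw [if_neg (Nat.succ_ne_zero j), pow_succ']
        ring
    rw [e]
    exact h
  have := (hasSum_nat_add_iff (f := fun j : ℕ => if j = 0 then A else B * p ^ j) 1).1 h'
  simpa [add_comm] using this

/-- Up to its product factor, row `i` has mass `1 + q i * p / (1 - p)`, which is `Theta p q i`. -/
lemma hasSum_chainMass (hp0 : 0 < p) (hp1 : p < 1) (hq0 : ∀ i, 0 ≤ q i) (hq1 : ∀ i, q i ≤ 1) :
    HasSum (chainMass p q T) (chainTotal p q T) := by
  have h := hasSum_prod_of_hasSum (f := chainMass p q T) (chainMass_nonneg hp0 hq0 hq1)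
    (g := fun i : Fin (T + 1) => Theta p q i * ∏ m ∈ Finset.range (i : ℕ), (1 - q m)) fun i => by
      have := (hasSum_ite_geometric hp0 hp1 1 (q i)).mul_left (∏ m ∈ Finset.range (i : ℕ), (1 - q m))
      have e : Theta p q i = 1 + q i * p / (1 - p) := by
        have : 1 - p ≠ 0 := by linarith
        rw [Theta]
        field_simp
        ring
      rw [e, mul_comm]
      exact this
  rw [chainTotal, ← Fin.sum_univ_eq_sum_range
    fun n => Theta p q n * ∏ m ∈ Finset.range n, (1 - q m)]
  exact h

/-- Away from `(0, 0)` the balance has a single term. Into `(0, 0)`, row `i` sends `q i` times its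
product, and these flows telescope to `1` because `q T = 1`. -/
lemma hasSum_chainMass_mul_transition (hp0 : 0 < p) (hp1 : p < 1) (hq0 : ∀ i, 0 ≤ q i)
    (hq1 : ∀ i, q i ≤ 1) (hqT : q T = 1) (s' : Fin (T + 1) × ℕ) :
    HasSum (fun s => chainMass p q T s * transition p q T s s') (chainMass p q T s') := by
  have hp : 1 - p ≠ 0 := by linarith
  obtain ⟨⟨i, hi⟩, j⟩ := s'
  cases j with
  | succ j =>
    have h := hasSum_mul_transition_succ (p := p) (q := q) (chainMass p q T) ⟨i, hi⟩ j
    rwa [← chainMass_succ] at h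
  | zero =>
    cases i with
    | succ i =>
      have h := hasSum_mul_transition_quiet (p := p) (q := q) (chainMass p q T)
        (Nat.lt_of_succ_lt_succ hi)
      convert h using 1
      simp [chainMass, Finset.prod_range_succ]
    | zero =>
      have h := hasSum_prod_of_hasSum (f := fun s => chainMass p q T s * transition p q T s (0, 0))
        (g := fun i => q i * ∏ m ∈ Finset.range (i : ℕ), (1 - q m)) (fun s => ?_) fun i => ?_
      · rw [Fin.sum_univ_eq_sum_range fun n => q n * ∏ m ∈ Finset.range n, (1 - q m),
          sum_mul_prod_one_sub, Finset.prod_range_succ, hqT, sub_self, mul_zero, sub_zero] at h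
        have e : chainMass p q T (⟨0, hi⟩, 0) = 1 := by simp [chainMass_row]
        rw [e]
        exact h
      · rw [transition_zero]
        refine mul_nonneg (chainMass_nonneg hp0 hq0 hq1 s) (mul_nonneg (by linarith) ?_)
        unfold attemptProb
        split_ifs
        · exact hq0 _
        · exact zero_le_one
      · have h := (hasSum_ite_geometric hp0 hp1 (q i) (q i)).mul_left
          ((1 - p) * ∏ m ∈ Finset.range (i : ℕ), (1 - q m))
        have e1 : (fun j => chainMass p q T (i, j) * transition p q T (i, j) (0, 0))
            = fun j => ((1 - p) * ∏ m ∈ Finset.range (i : ℕ), (1 - q m))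
              * if j = 0 then q i else q i * p ^ j := by
          ext j
          rw [transition_zero, chainMass, attemptProb]
          simp only
          split_ifs <;> ring
        have e2 : ((1 - p) * ∏ m ∈ Finset.range (i : ℕ), (1 - q m)) * (q i + q i * p / (1 - p))
            = q i * ∏ m ∈ Finset.range (i : ℕ), (1 - q m) := by
          field_simp
          ring
        rw [e2] at h
        rw [e1]
        exact h

lemma isInvariantDistribution_chainMass (hp0 : 0 < p) (hp1 : p < 1) (hq0 : ∀ i, 0 ≤ q i)
    (hq1 : ∀ i, q i ≤ 1) (hqT : q T = 1) :
    IsInvariantDistribution (transition p q T) fun s => chainMass p q T s / chainTotal p q T := by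
  have hS := chainTotal_pos (T := T) hp0 hp1 hq0 hq1
  refine ⟨fun s => div_nonneg (chainMass_nonneg hp0 hq0 hq1 s) hS.le, ?_, fun s' => ?_⟩
  · have := (hasSum_chainMass (T := T) hp0 hp1 hq0 hq1).div_const (chainTotal p q T)
    rwa [div_self hS.ne'] at this
  · have := (hasSum_chainMass_mul_transition hp0 hp1 hq0 hq1 hqT s').div_const (chainTotal p q T)
    simpa only [div_mul_eq_mul_div] using this

/-- The single-term balance equations propagate `π (0, 0)` along the rows `(i, 0)` and then in `j`;
total mass `1` fixes it. -/
lemma eq_of_isInvariantDistribution (hp0 : 0 < p) (hp1 : p < 1) (hq0 : ∀ i, 0 ≤ q i)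
    (hq1 : ∀ i, q i ≤ 1) {π : Fin (T + 1) × ℕ → ℝ}
    (hπ : IsInvariantDistribution (transition p q T) π) :
    π = fun s => chainMass p q T s / chainTotal p q T := by
  obtain ⟨-, h1, hinv⟩ := hπ
  have hS := chainTotal_pos (T := T) hp0 hp1 hq0 hq1
  have hrow : ∀ i (hi : i < T + 1), π (⟨i, hi⟩, 0)
      = π (0, 0) * ∏ m ∈ Finset.range i, (1 - q m) := by
    intro i hi
    induction i with
    | zero => simp
    | succ i ih =>
      rw [(hinv _).unique (hasSum_mul_transition_quiet π (Nat.lt_of_succ_lt_succ hi)),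
        ih (by omega), Finset.prod_range_succ, mul_assoc]
  have hall : ∀ i j, π (i, j) = π (0, 0) * chainMass p q T (i, j) := by
    intro i j
    induction j with
    | zero => rw [chainMass_row, ← hrow i i.2]
    | succ j ih =>
      rw [(hinv _).unique (hasSum_mul_transition_succ π i j), ih, chainMass_succ]
      ring
  have h2 : HasSum π (π (0, 0) * chainTotal p q T) := by
    have := (hasSum_chainMass (T := T) hp0 hp1 hq0 hq1).mul_left (π (0, 0))
    rwa [← (funext fun s => hall s.1 s.2 : π = fun s => π (0, 0) * chainMass p q T s)] at this
  have h3 : π (0, 0) = 1 / chainTotal p q T := by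
    rw [eq_div_iff hS.ne']
    exact h2.unique h1
  funext s
  rw [hall s.1 s.2, h3]
  ring

lemma chainMass_zero : chainMass p q T (0, 0) = 1 := by simp [chainMass]

end Chain

/-! ### The conditional quantities in the formula -/

section Conditional

variable {a ε : ℝ} {T : ℕ}

lemma attemptSet_of_lt {i : ℕ} (hi : i < T) :
    attemptSet a ε T i = {W | ε < |drift a W i|} ∩ quietSet a ε i := by
  ext W
  simp [attemptSet, hi, hi.le, and_comm]

lemma attemptSet_self : attemptSet a ε T T = quietSet a ε T := by
  ext W
  simp [attemptSet]

lemma quietSet_zero : quietSet a ε 0 = Set.univ := by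
  ext W
  simp [quietSet]

lemma quietSet_eq_union {i : ℕ} (hi : i < T) :
    quietSet a ε i = attemptSet a ε T i ∪ quietSet a ε (i + 1) := by
  ext W
  constructor
  · intro h
    rcases lt_or_ge ε |drift a W i| with h1 | h1
    · exact Or.inl ⟨hi.le, h, fun _ => h1⟩
    · refine Or.inr fun j hj => ?_
      rcases Nat.lt_succ_iff_lt_or_eq.1 hj with h2 | rfl
      · exact h j h2
      · exact h1
  · rintro (h | h)
    · exact h.2.1
    · exact fun j hj => h j (by omega)

lemma quiet_eq_preimage {Ω : Type*} (a ε : ℝ) (w : ℕ → Ω → ℝ) (i : ℕ) :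
    quiet a ε w i = (fun ω k => w k ω) ⁻¹' quietSet a ε i := by
  ext ω
  simp only [quiet, quietSet, xi_eq_drift]
  rfl

lemma crossing_inter_quiet_eq_preimage {Ω : Type*} {w : ℕ → Ω → ℝ} {i : ℕ} (hi : i < T) :
    crossing a ε w i ∩ quiet a ε w i = (fun ω k => w k ω) ⁻¹' attemptSet a ε T i := by
  rw [attemptSet_of_lt hi, quiet_eq_preimage]
  ext ω
  simp only [crossing, xi_eq_drift]
  rfl

variable {Ω : Type*} [MeasurableSpace Ω] {P : Measure Ω}

/-- The multiplied form remains true for null events, where both sides are zero. -/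
lemma measureReal_mul_variance_cond [IsProbabilityMeasure P] {A : Set Ω} {X : Ω → ℝ}
    (hX : Measurable X) (h0 : ∫ ω in A, X ω ∂P = 0) :
    P.real A * variance X (cond P A) = ∫ ω in A, X ω ^ 2 ∂P := by
  have hi : ∀ f : Ω → ℝ, ∫ ω, f ω ∂cond P A = (P.real A)⁻¹ * ∫ ω in A, f ω ∂P := fun f => by
    rw [ProbabilityTheory.cond, integral_smul_measure, ENNReal.toReal_inv, smul_eq_mul]
    rfl
  rw [variance_of_integral_eq_zero hX.aemeasurable (by rw [hi, h0, mul_zero]), hi]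
  rcases eq_or_ne (P.real A) 0 with h | h
  · have : P.restrict A = 0 := by
      rwa [Measure.restrict_eq_zero, ← measureReal_eq_zero_iff]
    simp [h, this]
  · rw [mul_inv_cancel_left₀ h]

variable {ν : Measure ℝ} [IsProbabilityMeasure ν] {w : ℕ → Ω → ℝ}

lemma pZero_mem (i : ℕ) : 0 ≤ pZero P a ε T w i ∧ pZero P a ε T w i ≤ 1 := by
  unfold pZero
  split_ifs
  · exact ⟨measureReal_nonneg, measureReal_le_one⟩
  · exact ⟨zero_le_one, le_rfl⟩

lemma setIntegral_preimage_drift (hw : Measurable fun ω k => w k ω)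
    (hl : P.map (fun ω k => w k ω) = seqLaw ν) {D : Set (ℕ → ℝ)} (hD : MeasurableSet D)
    {g : ℝ → ℝ} (hg : Measurable g) (i : ℕ) :
    ∫ ω in (fun ω k => w k ω) ⁻¹' D, g (xi a w i ω) ∂P = ∫ W in D, g (drift a W i) ∂seqLaw ν := by
  have h := setIntegral_map (μ := P) (g := fun ω k => w k ω) (f := fun W => g (drift a W i)) hD
    (hg.comp (measurable_drift a i)).aestronglyMeasurable hw.aemeasurable
  rw [hl] at h
  rw [h]
  simp only [xi_eq_drift]

variable [IsProbabilityMeasure P]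

/-- At `i = T` the convention `pZero = 1` matches the time-out: the attempt event is the whole quiet
event. -/
lemma pZero_mul_quiet (hw : Measurable fun ω k => w k ω) (hl : P.map (fun ω k => w k ω) = seqLaw ν)
    {i : ℕ} (hi : i ≤ T) :
    pZero P a ε T w i * (seqLaw ν).real (quietSet a ε i) = (seqLaw ν).real (attemptSet a ε T i) := by
  rcases hi.lt_or_eq with h | rfl
  · have hq : (seqLaw ν).real (quietSet a ε i) = P.real (quiet a ε w i) := by
      rw [quiet_eq_preimage, ← hl, map_measureReal_apply hw (measurableSet_quietSet _ _ _)]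
    have hat : (seqLaw ν).real (attemptSet a ε T i)
        = P.real (quiet a ε w i ∩ crossing a ε w i) := by
      rw [Set.inter_comm, crossing_inter_quiet_eq_preimage h, ← hl,
        map_measureReal_apply hw (measurableSet_attemptSet _ _ _ _)]
    have hm : MeasurableSet (quiet a ε w i) := by
      rw [quiet_eq_preimage]
      exact hw (measurableSet_quietSet _ _ _)
    rw [hq, hat, pZero, if_pos h, mul_comm, measureReal_def (μ := ProbabilityTheory.cond P _), cond_apply hm,
      ENNReal.toReal_mul, ENNReal.toReal_inv, ← measureReal_def, ← measureReal_def]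
    rcases eq_or_ne (P.real (quiet a ε w i)) 0 with h0 | h0
    · rw [h0, zero_mul]
      exact (measureReal_mono_null Set.inter_subset_left h0).symm
    · rw [mul_inv_cancel_left₀ h0]
  · rw [pZero, if_neg (lt_irrefl _), one_mul, attemptSet_self]

lemma real_quietSet_eq_prod (hw : Measurable fun ω k => w k ω)
    (hl : P.map (fun ω k => w k ω) = seqLaw ν) {i : ℕ} (hi : i ≤ T) :
    (seqLaw ν).real (quietSet a ε i) = ∏ j ∈ Finset.range i, (1 - pZero P a ε T w j) := by
  induction i with
  | zero => simp [quietSet_zero]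
  | succ i ih =>
    have h1 := pZero_mul_quiet (a := a) (ε := ε) hw hl (show i ≤ T by omega)
    have h2 : (seqLaw ν).real (quietSet a ε i) = (seqLaw ν).real (attemptSet a ε T i)
        + (seqLaw ν).real (quietSet a ε (i + 1)) := by
      rw [quietSet_eq_union hi, measureReal_union _ (measurableSet_quietSet _ _ _)]
      exact Set.disjoint_left.2 fun W h => notMem_quietSet_of_attempt h (Nat.lt_succ_self i) hi
    rw [Finset.prod_range_succ, ← ih (by omega)]
    linarith

lemma real_mul_variance_cond_preimage (hw : Measurable fun ω k => w k ω)
    (hl : P.map (fun ω k => w k ω) = seqLaw ν) (hneg : ν.map (fun x => -x) = ν)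
    {D : Set (ℕ → ℝ)} (hD : MeasurableSet D) (hsym : ∀ W, -W ∈ D ↔ W ∈ D) (i : ℕ) :
    (seqLaw ν).real D * variance (xi a w i) (cond P ((fun ω k => w k ω) ⁻¹' D))
      = ∫ W in D, drift a W i ^ 2 ∂seqLaw ν := by
  have hm : Measurable (xi a w i) := by
    have : xi a w i = fun ω => drift a (fun k => w k ω) i := funext fun ω => xi_eq_drift a w i ω
    rw [this]
    exact (measurable_drift a i).comp hw
  have h1 := setIntegral_preimage_drift (a := a) hw hl hD measurable_id i
  have h2 := setIntegral_preimage_drift (a := a) hw hl hD (measurable_id.pow_const 2) i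
  simp only [id] at h1 h2
  rw [setIntegral_drift_eq_zero hneg hsym] at h1
  rw [← h2, ← measureReal_mul_variance_cond hm h1, ← hl, map_measureReal_apply hw hD]

lemma quiet_mul_varQuiet (hw : Measurable fun ω k => w k ω)
    (hl : P.map (fun ω k => w k ω) = seqLaw ν) (hneg : ν.map (fun x => -x) = ν) (i : ℕ) :
    (seqLaw ν).real (quietSet a ε (i + 1)) * varQuiet P a ε w i
      = ∫ W in quietSet a ε (i + 1), drift a W i ^ 2 ∂seqLaw ν := by
  rw [varQuiet, quiet_eq_preimage]
  exact real_mul_variance_cond_preimage hw hl hneg (measurableSet_quietSet _ _ _)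
    (fun W => neg_mem_quietSet W _) i

/-- At the time-out the event does not involve `w T`, so one step of the recursion from `ξ_{T-1}`
gives `varTimeout`; for `T = 0` only the noise variance is left. -/
lemma attempt_mul_varCross (hw : Measurable fun ω k => w k ω)
    (hl : P.map (fun ω k => w k ω) = seqLaw ν) (hneg : ν.map (fun x => -x) = ν)
    (h2 : MemLp id 2 ν) (hm : ∫ x, x ∂ν = 0) {σ : ℝ} (hs : ∫ x, x ^ 2 ∂ν = σ ^ 2)
    {i : ℕ} (hi : i ≤ T) :
    (seqLaw ν).real (attemptSet a ε T i) * varCross P a ε σ T w i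
      = ∫ W in attemptSet a ε T i, drift a W i ^ 2 ∂seqLaw ν := by
  rcases hi.lt_or_eq with h | rfl
  · rw [varCross, if_pos h, crossing_inter_quiet_eq_preimage h]
    exact real_mul_variance_cond_preimage hw hl hneg (measurableSet_attemptSet _ _ _ _)
      (fun W => neg_mem_attemptSet W _) i
  · rw [varCross, if_neg (lt_irrefl _), attemptSet_self]
    cases i with
    | zero =>
      simp only [quietSet_zero, varTimeout, drift, Measure.restrict_univ, probReal_univ, one_mul]
      rw [← hs]
      exact (integral_eval_seqLaw (measurable_id.pow_const 2) 0).symm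
    | succ t =>
      have h := quiet_mul_varQuiet (a := a) (ε := ε) hw hl hneg t
      rw [varQuiet] at h
      rw [setIntegral_drift_sq_succ h2 hm hs (measurableSet_quietSet _ _ _) t
        fun W => mem_quietSet_truncSeq 0 W le_rfl, ← h, varTimeout]
      ring

end Conditional

/-! ### The loop in the formula's terms -/

section Main

variable {Ω : Type*} [MeasurableSpace Ω] {P : Measure Ω} [IsProbabilityMeasure P]

/-- The driving sequence of the loop is a sequence of independent, identically distributed
variables, with independent noise and channel parts. -/
lemma exists_joint_law {ν₁ : Measure ℝ} [IsProbabilityMeasure ν₁] {p : ℝ}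
    (hp1 : p < 1) {w : ℕ → Ω → ℝ} {L : ℕ → Ω → Bool}
    (hw : ∀ k, Measurable (w k)) (hwl : ∀ k, P.map (w k) = ν₁) (hwi : iIndepFun w P)
    (hL : ∀ k, Measurable (L k)) (hLp : ∀ k, P {ω | L k ω = true} = ENNReal.ofReal p)
    (hLi : iIndepFun L P) (hwL : IndepFun (fun ω k => w k ω) (fun ω k => L k ω) P) :
    ∃ (ν : Measure (ℝ × Bool)) (_ : IsProbabilityMeasure ν),
      P.map (fun ω k => (w k ω, L k ω)) = seqLaw ν ∧
      (seqLaw ν).map noise = seqLaw ν₁ ∧ IndepFun noise losses (seqLaw ν) ∧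
      (∀ i m, (seqLaw ν).map losses (lostSet i (i + m)) = ENNReal.ofReal p ^ m) ∧
      (∀ i m, (seqLaw ν).map losses (lostUntilSet i (i + m))
        = ENNReal.ofReal p ^ m * (1 - ENNReal.ofReal p)) ∧
      ν {q | q.2 = false} ≠ 0 := by
  have hZ : ∀ k, Measurable fun ω => (w k ω, L k ω) := fun k => (hw k).prodMk (hL k)
  have hZs : Measurable fun ω k => (w k ω, L k ω) := measurable_pi_iff.2 hZ
  have hν : IsProbabilityMeasure (P.map fun ω => (w 0 ω, L 0 ω)) :=
    Measure.isProbabilityMeasure_map (hZ 0).aemeasurable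
  have hlaw : ∀ k, P.map (fun ω => (w k ω, L k ω)) = P.map fun ω => (w 0 ω, L 0 ω) := by
    have h : ∀ k, P.map (fun ω => (w k ω, L k ω)) = ν₁.prod (P.map (L 0)) := fun k => by
      have hi : IndepFun (w k) (L k) P :=
        hwL.comp (φ := fun x : ℕ → ℝ => x k) (ψ := fun x : ℕ → Bool => x k)
          (measurable_pi_apply k) (measurable_pi_apply k)
      rw [(indepFun_iff_map_prod_eq_prod_map_map (hw k).aemeasurable (hL k).aemeasurable).1 hi, hwl,
        map_bool_eq (hL k) (hL 0) ((hLp k).trans (hLp 0).symm)]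
    exact fun k => (h k).trans (h 0).symm
  have hmap : P.map (fun ω k => (w k ω, L k ω)) = seqLaw (P.map fun ω => (w 0 ω, L 0 ω)) :=
    map_seq_eq_seqLaw hZ (iIndepFun_pair hw hL hwi hLi hwL) hlaw
  have hmapL : (seqLaw (P.map fun ω => (w 0 ω, L 0 ω))).map losses = P.map fun ω k => L k ω := by
    rw [← hmap, Measure.map_map measurable_losses hZs]
    rfl
  refine ⟨_, hν, hmap, ?_, ?_, ?_, ?_, ?_⟩
  · rw [← hmap, Measure.map_map measurable_noise hZs]
    exact map_seq_eq_seqLaw hw hwi hwl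
  · rw [← hmap, indepFun_iff_measure_inter_preimage_eq_mul]
    intro A B hA hB
    rw [Measure.map_apply hZs ((measurable_noise hA).inter (measurable_losses hB)),
      Measure.map_apply hZs (measurable_noise hA), Measure.map_apply hZs (measurable_losses hB)]
    exact hwL.measure_inter_preimage_eq_mul A B hA hB
  · intro i m
    rw [hmapL]
    exact measure_lostSet hL hLi hLp i m
  · intro i m
    rw [hmapL]
    exact measure_lostUntilSet hL hLi hLp i m
  · have hF : MeasurableSet {q : ℝ × Bool | q.2 = false} :=
      measurable_snd (measurableSet_singleton false)
    rw [Measure.map_apply (hZ 0) hF]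
    have e : (fun ω => (w 0 ω, L 0 ω)) ⁻¹' {q | q.2 = false} = {ω | L 0 ω = true}ᶜ := by
      ext ω
      simp
    have hT : MeasurableSet {ω | L 0 ω = true} := hL 0 (measurableSet_singleton true)
    rw [e, prob_compl_eq_one_sub hT, hLp]
    refine (tsub_pos_of_lt ?_).ne'
    rwa [← ENNReal.ofReal_one, ENNReal.ofReal_lt_ofReal_iff one_pos]

variable {ν₁ : Measure ℝ} [IsProbabilityMeasure ν₁] {ν : Measure (ℝ × Bool)}
  [IsProbabilityMeasure ν] {a b K ε p : ℝ} {T : ℕ}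

/-- Weights `(1, 1)` measure the cycle length and `(1, 0)` count its receptions. -/
lemma integral_cycleCost_const (hp0 : 0 < p) (hp1 : p < 1)
    (hnoise : (seqLaw ν).map noise = seqLaw ν₁) (hind : IndepFun noise losses (seqLaw ν))
    (hlost : ∀ i m, (seqLaw ν).map losses (lostSet i (i + m)) = ENNReal.ofReal p ^ m)
    (hlostU : ∀ i m, (seqLaw ν).map losses (lostUntilSet i (i + m))
      = ENNReal.ofReal p ^ m * (1 - ENNReal.ofReal p))
    (hν : ν {q | q.2 = false} ≠ 0) {c₀ c₁ : ℝ} (h₀ : 0 ≤ c₀) (h₁ : 0 ≤ c₁) :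
    Integrable (cycleCost a b K ε T (weightedCost c₀ c₁ fun _ => 1)) (seqLaw ν) ∧
      ∫ z, cycleCost a b K ε T (weightedCost c₀ c₁ fun _ => 1) z ∂seqLaw ν
        = c₁ * ∑ k ∈ Finset.range T, (seqLaw ν₁).real (quietSet a ε (k + 1))
          + (c₁ * p + c₀ * (1 - p))
            * ∑ i ∈ Finset.range (T + 1), (seqLaw ν₁).real (attemptSet a ε T i) / (1 - p) := by
  have h := integral_cycleCost (a := a) (b := b) (K := K) (ε := ε) (T := T) (μ := seqLaw ν)
    hp0.le hp1 (ae_cycleLength_pos hν) hind hlost hlostU (g := fun _ => 1) measurable_const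
    (fun _ => zero_le_one) (fun k => by rw [hnoise]; exact integrable_const _) h₀ h₁
    (H := fun i => (seqLaw ν₁).real (attemptSet a ε T i) / (1 - p)) (fun i => by
      rw [hnoise]
      have := (hasSum_geometric_of_lt_one hp0.le hp1).mul_right
        ((seqLaw ν₁).real (attemptSet a ε T i))
      rw [inv_mul_eq_div] at this
      simpa using this)
  rw [hnoise] at h
  simpa using h

lemma integral_cycleCost_sq (hp0 : 0 < p) (hp1 : p < 1) (hstab : p * a ^ 2 < 1)
    (hnoise : (seqLaw ν).map noise = seqLaw ν₁) (hind : IndepFun noise losses (seqLaw ν))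
    (hlost : ∀ i m, (seqLaw ν).map losses (lostSet i (i + m)) = ENNReal.ofReal p ^ m)
    (hlostU : ∀ i m, (seqLaw ν).map losses (lostUntilSet i (i + m))
      = ENNReal.ofReal p ^ m * (1 - ENNReal.ofReal p))
    (hν : ν {q | q.2 = false} ≠ 0) (h2 : MemLp id 2 ν₁) (hm : ∫ x, x ∂ν₁ = 0) {σ : ℝ}
    (hs : ∫ x, x ^ 2 ∂ν₁ = σ ^ 2) {c₀ c₁ : ℝ} (h₀ : 0 ≤ c₀) (h₁ : 0 ≤ c₁) :
    Integrable (cycleCost a b K ε T (weightedCost c₀ c₁ fun x => x ^ 2)) (seqLaw ν) ∧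
      ∫ z, cycleCost a b K ε T (weightedCost c₀ c₁ fun x => x ^ 2) z ∂seqLaw ν
        = c₁ * ∑ k ∈ Finset.range T, ∫ W in quietSet a ε (k + 1), drift a W k ^ 2 ∂seqLaw ν₁
          + (c₁ * p + c₀ * (1 - p)) * ∑ i ∈ Finset.range (T + 1),
            (∫ W in attemptSet a ε T i, drift a W i ^ 2 ∂seqLaw ν₁
              + p * (σ ^ 2 * (seqLaw ν₁).real (attemptSet a ε T i)) / (1 - p))
              / (1 - p * a ^ 2) := by
  have h := integral_cycleCost (a := a) (b := b) (K := K) (ε := ε) (T := T) (μ := seqLaw ν)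
    hp0.le hp1 (ae_cycleLength_pos hν) hind hlost hlostU (g := fun x => x ^ 2)
    (measurable_id.pow_const 2) (fun x => sq_nonneg x)
    (fun k => by rw [hnoise]; exact integrable_drift_sq h2 a k) h₀ h₁
    (H := fun i => (∫ W in attemptSet a ε T i, drift a W i ^ 2 ∂seqLaw ν₁
      + p * (σ ^ 2 * (seqLaw ν₁).real (attemptSet a ε T i)) / (1 - p)) / (1 - p * a ^ 2))
    (fun i => by
      rw [hnoise]
      exact hasSum_geometric_affine
        (v := fun m => ∫ W in attemptSet a ε T i, drift a W (i + m) ^ 2 ∂seqLaw ν₁) hp0.le hp1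
        hstab (fun m => integral_nonneg fun W => sq_nonneg _)
        (mul_nonneg (sq_nonneg σ) measureReal_nonneg) fun m =>
          setIntegral_drift_sq_succ h2 hm hs (measurableSet_attemptSet a ε T i) (i + m)
            fun W => mem_attemptSet_truncSeq 0 W (by omega))
  rwa [hnoise] at h

lemma cycleCost_one (z : ℕ → ℝ × Bool) :
    cycleCost a b K ε T (weightedCost 1 1 fun _ => 1) z = cycleLength a b K ε T z := by
  simp [cycleCost, weightedCost]

/-- The cost of the formula in terms of unconditional moments. -/
lemma loss_formula {T : ℕ} {q Pr V F vq sc : ℕ → ℝ} {Q c₁ p σ : ℝ}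
    (hPr : ∀ i, Pr i = ∏ j ∈ Finset.range i, (1 - q j))
    (hF : ∀ k < T, Pr (k + 1) * vq k = F k)
    (hV : ∀ i ≤ T, q i * Pr i * sc i = V i) :
    q 0 * Q * (sc 0 + p * σ ^ 2 / (1 - p)) + ∑ i ∈ Finset.Icc 1 T,
        (c₁ * vq (i - 1) + q i * Q * (sc i + p * σ ^ 2 / (1 - p)))
          * ∏ j ∈ Finset.range i, (1 - q j)
      = c₁ * ∑ k ∈ Finset.range T, F k
        + Q * ∑ i ∈ Finset.range (T + 1), (V i + p * (σ ^ 2 * (q i * Pr i)) / (1 - p)) := by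
  have h1 : ∀ i ∈ Finset.Ico 1 (T + 1), (c₁ * vq (i - 1) + q i * Q * (sc i + p * σ ^ 2 / (1 - p)))
          * ∏ j ∈ Finset.range i, (1 - q j)
      = c₁ * (Pr i * vq (i - 1)) + Q * (V i + p * (σ ^ 2 * (q i * Pr i)) / (1 - p)) := by
    intro i hi
    have := hV i (by have := Finset.mem_Ico.1 hi; omega)
    rw [← hPr, ← this]
    ring
  have h0 : Pr 0 = 1 := by simp [hPr]
  have h2 : ∑ i ∈ Finset.Ico 1 (T + 1), c₁ * (Pr i * vq (i - 1))
      = c₁ * ∑ k ∈ Finset.range T, F k := by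
    rw [Finset.sum_Ico_eq_sum_range, Finset.mul_sum]
    refine Finset.sum_congr rfl fun k hk => ?_
    rw [← hF k (Finset.mem_range.1 hk), add_comm 1 k, Nat.add_sub_cancel]
  have h3 : Finset.Icc 1 T = Finset.Ico 1 (T + 1) := rfl
  rw [h3, Finset.sum_congr rfl h1, Finset.sum_add_distrib, h2, ← Finset.mul_sum,
    Finset.sum_range_eq_add_Ico _ (Nat.succ_pos T), ← hV 0 (Nat.zero_le T), h0]
  ring

end Main

end ErasureLoop

/-! ### Receptions, control loss and the invariant distribution -/

theorem theorem4 {Ω : Type*} [MeasurableSpace Ω] (P : Measure Ω) [IsProbabilityMeasure P]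
    -- the plant, the dead-beat gain, the weights, the trigger, and the loss probability
    (a b K Qx Qu ρ ε p : ℝ) (T : ℕ)
    (hb : b ≠ 0) (hK : K = -a / b) (hQx : 0 ≤ Qx) (hQu : 0 < Qu) (hε : 0 < ε)
    (hp0 : 0 < p) (hp1 : p < 1)
    -- the standard deviations of the process noise and of the initial plant state
    (σw σ0 : NNReal) (hσw : 0 < σw)
    -- the process noise, the channel, and the initial condition
    (w : ℕ → Ω → ℝ) (lost : ℕ → Ω → Bool) (x0 : Ω → ℝ) (r0 γ0 : Ω → ℕ)
    (hw_meas : ∀ k, Measurable (w k)) (hw_law : ∀ k, P.map (w k) = gaussianReal 0 (σw ^ 2))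
    (hw_indep : iIndepFun w P)
    (hl_meas : ∀ k, Measurable (lost k))
    (hl_law : ∀ k, P {ω | lost k ω = true} = ENNReal.ofReal p)
    (hl_indep : iIndepFun lost P)
    (hx_meas : Measurable x0) (hx_law : P.map x0 = gaussianReal 0 (σ0 ^ 2))
    (hr_meas : Measurable r0) (hγ_meas : Measurable γ0)
    (hwl_indep : IndepFun (fun ω k => w k ω) (fun ω k => lost k ω) P)
    (h0_indep : IndepFun (fun ω => (x0 ω, r0 ω, γ0 ω))
      (fun ω => ((fun k => w k ω), (fun k => lost k ω))) P)
    (hstab : p * a ^ 2 < 1) :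
    ∃ π : Fin (T + 1) × ℕ → ℝ,
      -- `π` is the unique invariant distribution of the chain `(r, γ)`
      ErasureLoop.IsInvariantDistribution
        (ErasureLoop.transition p (ErasureLoop.pZero P a ε T w) T) π ∧
      (∀ π' : Fin (T + 1) × ℕ → ℝ, ErasureLoop.IsInvariantDistribution
        (ErasureLoop.transition p (ErasureLoop.pZero P a ε T w) T) π' → π' = π) ∧
      -- `π (0, 0)` in closed form, and as the rate of successful receptions
      π (0, 0) = 1 / (ErasureLoop.Theta p (ErasureLoop.pZero P a ε T w) 0
        + ∑ n ∈ Finset.Icc 1 T, ErasureLoop.Theta p (ErasureLoop.pZero P a ε T w) n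
          * ∏ m ∈ Finset.range n, (1 - ErasureLoop.pZero P a ε T w m)) ∧
      (∀ᵐ ω ∂P, Tendsto (fun N : ℕ => (∑ k ∈ Finset.range N,
          if (ErasureLoop.trajectory a b K ε T (x0 ω, r0 ω, γ0 ω) (fun k => w k ω)
            (fun k => lost k ω) k).2 = (0, 0) then (1 : ℝ) else 0) / (N : ℝ))
        atTop (𝓝 (π (0, 0)))) ∧
      -- the control loss
      (∀ᵐ ω ∂P, Tendsto (fun N : ℕ => (1 / (N : ℝ)) * ∑ k ∈ Finset.range N,
          ErasureLoop.stageCost Qx Qu ρ K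
            (ErasureLoop.trajectory a b K ε T (x0 ω, r0 ω, γ0 ω) (fun k => w k ω)
              (fun k => lost k ω) k))
        atTop (𝓝 ((ErasureLoop.pZero P a ε T w 0 * ErasureLoop.Qhat a K Qx Qu ρ p
            * (ErasureLoop.varCross P a ε σw T w 0 + p * (σw : ℝ) ^ 2 / (1 - p))
          + ∑ i ∈ Finset.Icc 1 T, (Qx * ErasureLoop.varQuiet P a ε w (i - 1)
              + ErasureLoop.pZero P a ε T w i * ErasureLoop.Qhat a K Qx Qu ρ p
                * (ErasureLoop.varCross P a ε σw T w i + p * (σw : ℝ) ^ 2 / (1 - p)))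
            * ∏ j ∈ Finset.range i, (1 - ErasureLoop.pZero P a ε T w j)) * π (0, 0)))) := by
  set q := ErasureLoop.pZero P a ε T w with hq
  set ν₁ := gaussianReal 0 (σw ^ 2) with hν₁
  have hw : Measurable fun ω k => w k ω := measurable_pi_iff.2 hw_meas
  have hwl : P.map (fun ω k => w k ω) = ErasureLoop.seqLaw ν₁ :=
    ErasureLoop.map_seq_eq_seqLaw hw_meas hw_indep hw_law
  have h2 : MemLp id 2 ν₁ := memLp_id_gaussianReal 2
  have hm : ∫ x, x ∂ν₁ = 0 := integral_id_gaussianReal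
  have hs : ∫ x, x ^ 2 ∂ν₁ = (σw : ℝ) ^ 2 := by
    rw [← variance_of_integral_eq_zero (X := fun x : ℝ => x) measurable_id.aemeasurable hm]
    rw [hν₁, variance_fun_id_gaussianReal, NNReal.coe_pow]
  have hneg : ν₁.map (fun x => -x) = ν₁ := by rw [hν₁, gaussianReal_map_neg, neg_zero]
  have hab : a + b * K = 0 := by
    rw [hK]
    field_simp
    ring
  have hq0 : ∀ i, 0 ≤ q i := fun i => (ErasureLoop.pZero_mem i).1
  have hq1 : ∀ i, q i ≤ 1 := fun i => (ErasureLoop.pZero_mem i).2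
  have hqT : q T = 1 := by rw [hq, ErasureLoop.pZero, if_neg (lt_irrefl T)]
  -- The noise `w k` and the outcome `lost (k + 1)` act in the same step and form one driving pair.
  have hwL : IndepFun (fun ω k => w k ω) (fun ω k => lost (k + 1) ω) P :=
    hwl_indep.comp (φ := id) (ψ := fun l : ℕ → Bool => fun k => l (k + 1)) measurable_id
      (measurable_pi_iff.2 fun k => measurable_pi_apply (k + 1))
  obtain ⟨ν, hνp, hmap, hnoise, hind, hlost, hlostU, hν⟩ := ErasureLoop.exists_joint_law
    hp1 hw_meas hw_law hw_indep (fun k => hl_meas (k + 1)) (fun k => hl_law (k + 1))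
    (hl_indep.precomp (add_left_injective 1)) hwL
  set S := ErasureLoop.chainTotal p q T with hS
  have hSpos : 0 < S := ErasureLoop.chainTotal_pos hp0 hp1 hq0 hq1
  set Pr : ℕ → ℝ := fun i => ∏ j ∈ Finset.range i, (1 - q j) with hPr
  have hF : ∀ i ≤ T, (ErasureLoop.seqLaw ν₁).real (ErasureLoop.quietSet a ε i) = Pr i :=
    fun i hi => ErasureLoop.real_quietSet_eq_prod hw hwl hi
  have hD : ∀ i ≤ T, (ErasureLoop.seqLaw ν₁).real (ErasureLoop.attemptSet a ε T i) = q i * Pr i :=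
    fun i hi => by rw [← ErasureLoop.pZero_mul_quiet hw hwl hi, hF i hi]
  have hDsum : ∑ i ∈ Finset.range (T + 1), q i * Pr i = 1 := by
    rw [ErasureLoop.sum_mul_prod_one_sub, Finset.prod_range_succ, hqT]
    ring
  have hDsum' : ∑ i ∈ Finset.range (T + 1),
      (ErasureLoop.seqLaw ν₁).real (ErasureLoop.attemptSet a ε T i) / (1 - p) = 1 / (1 - p) := by
    rw [← Finset.sum_div, ← hDsum]
    congr 1
    exact Finset.sum_congr rfl fun i hi => hD i (Nat.lt_succ_iff.1 (Finset.mem_range.1 hi))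
  have hp1' : 1 - p ≠ 0 := by linarith
  have hpa : 1 - p * a ^ 2 ≠ 0 := by linarith
  have hone := fun c₀ c₁ h₀ h₁ => ErasureLoop.integral_cycleCost_const (a := a) (b := b) (K := K)
    (ε := ε) (T := T) (c₀ := c₀) (c₁ := c₁) hp0 hp1 hnoise hind hlost hlostU hν h₀ h₁
  have hsq := fun c₀ c₁ h₀ h₁ => ErasureLoop.integral_cycleCost_sq (a := a) (b := b) (K := K)
    (ε := ε) (T := T) (c₀ := c₀) (c₁ := c₁) hp0 hp1 hstab hnoise hind hlost hlostU hν h2 hm hs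
    h₀ h₁
  obtain ⟨hτi, hτ⟩ := hone 1 1 zero_le_one zero_le_one
  have hcyc := funext (ErasureLoop.cycleCost_one (a := a) (b := b) (K := K) (ε := ε) (T := T))
  rw [hcyc] at hτi
  simp only [ErasureLoop.cycleCost_one] at hτ
  -- The mean return time is the mass of the invariant measure normalized at `(0, 0)`, seen from
  -- `Theta p q n = 1 + p / (1 - p) * q n`.
  have hτS : ∫ z, (ErasureLoop.cycleLength a b K ε T z : ℝ) ∂ErasureLoop.seqLaw ν = S := by
    have e : ∀ n ∈ Finset.range (T + 1), ErasureLoop.Theta p q n * ∏ m ∈ Finset.range n, (1 - q m)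
        = Pr n + p / (1 - p) * (q n * Pr n) := fun n _ => by
      rw [ErasureLoop.Theta]
      field_simp
      ring
    have e2 : ∀ k ∈ Finset.range T,
        (ErasureLoop.seqLaw ν₁).real (ErasureLoop.quietSet a ε (k + 1)) = Pr (k + 1) :=
      fun k hk => hF (k + 1) (Finset.mem_range.1 hk)
    have e3 : Pr 0 = 1 := Finset.prod_range_zero _
    rw [hτ, hDsum', hS, ErasureLoop.chainTotal, Finset.sum_congr rfl e, Finset.sum_add_distrib,
      ← Finset.mul_sum, hDsum, Finset.sum_range_succ' Pr, e3, Finset.sum_congr rfl e2]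
    field_simp
    ring
  have havg : ∀ c₀ c₁ : ℝ, 0 ≤ c₀ → 0 ≤ c₁ → ∀ g : ℝ → ℝ, Measurable g → (∀ x, 0 ≤ g x) →
      Integrable (ErasureLoop.cycleCost a b K ε T (ErasureLoop.weightedCost c₀ c₁ g))
        (ErasureLoop.seqLaw ν) →
      ∀ᵐ ω ∂P, Tendsto (fun N : ℕ => (∑ k ∈ Finset.range N, ErasureLoop.weightedCost c₀ c₁ g
          (ErasureLoop.trajectory a b K ε T (x0 ω, r0 ω, γ0 ω) (fun k => w k ω)
            (fun k => lost k ω) k)) / (N : ℝ)) atTop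
        (𝓝 ((∫ z, ErasureLoop.cycleCost a b K ε T (ErasureLoop.weightedCost c₀ c₁ g) z
          ∂ErasureLoop.seqLaw ν) / S)) := by
    intro c₀ c₁ h₀ h₁ g hg hg0 hi
    have h := ErasureLoop.ae_tendsto_average_loop hab hν
      (ErasureLoop.measurable_weightedCost c₀ c₁ hg)
      (ErasureLoop.weightedCost_nonneg h₀ h₁ hg0) hτi hi
    rw [hτS] at h
    have hZ : Measurable fun ω k => (w k ω, lost (k + 1) ω) :=
      measurable_pi_iff.2 fun k => (hw_meas k).prodMk (hl_meas (k + 1))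
    have h' : ∀ᵐ z ∂P.map fun ω k => (w k ω, lost (k + 1) ω), ∀ s, Tendsto (fun N : ℕ =>
        (∑ k ∈ Finset.range N, ErasureLoop.weightedCost c₀ c₁ g
          (ErasureLoop.loop a b K ε T s z k)) / (N : ℝ)) atTop
        (𝓝 ((∫ z, ErasureLoop.cycleCost a b K ε T (ErasureLoop.weightedCost c₀ c₁ g) z
          ∂ErasureLoop.seqLaw ν) / S)) := by
      rw [hmap]
      exact h
    -- Since `h'` holds for all initial states at once, the random one may be inserted.
    filter_upwards [ae_of_ae_map hZ.aemeasurable h'] with ω hω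
    simp only [ErasureLoop.trajectory_eq_loop]
    exact hω _
  refine ⟨fun s => ErasureLoop.chainMass p q T s / S,
    ErasureLoop.isInvariantDistribution_chainMass hp0 hp1 hq0 hq1 hqT,
    fun π' hπ' => ErasureLoop.eq_of_isInvariantDistribution hp0 hp1 hq0 hq1 hπ', ?_, ?_, ?_⟩
  · simp only [ErasureLoop.chainMass_zero]
    rw [hS, ErasureLoop.chainTotal_eq]
  -- Each cycle contains one reception, so the frequency is `1 / S`.
  · obtain ⟨hi, hI⟩ := hone 1 0 zero_le_one le_rfl
    have hval : (1 - p) * (1 / (1 - p)) = 1 := by field_simp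
    rw [hDsum', zero_mul, zero_mul, zero_add, zero_add, one_mul, hval] at hI
    filter_upwards [havg 1 0 zero_le_one le_rfl (fun _ => 1) measurable_const
      (fun _ => zero_le_one) hi] with ω hω
    rw [hI] at hω
    simpa only [ErasureLoop.weightedCost, mul_one, ErasureLoop.chainMass_zero] using hω
  -- As `ρ` may be negative, the stage cost is split into multiples of two nonnegative costs: `x ^
  -- 2` at all times, and `x ^ 2` at receptions only.
  · obtain ⟨hi1, hI1⟩ := hsq 1 1 zero_le_one zero_le_one
    obtain ⟨hi2, hI2⟩ := hsq 1 0 zero_le_one le_rfl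
    filter_upwards [
      havg 1 1 zero_le_one zero_le_one (fun x => x ^ 2) (measurable_id.pow_const 2) sq_nonneg hi1,
      havg 1 0 zero_le_one le_rfl (fun x => x ^ 2) (measurable_id.pow_const 2) sq_nonneg hi2]
      with ω h1 h2'
    rw [hI1] at h1
    rw [hI2] at h2'
    have hlim := (h1.const_mul Qx).add (h2'.const_mul (ρ * Qu * K ^ 2))
    set V : ℕ → ℝ := fun i => ∫ W in ErasureLoop.attemptSet a ε T i,
      ErasureLoop.drift a W i ^ 2 ∂ErasureLoop.seqLaw ν₁ with hVdef
    set F : ℕ → ℝ := fun k => ∫ W in ErasureLoop.quietSet a ε (k + 1),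
      ErasureLoop.drift a W k ^ 2 ∂ErasureLoop.seqLaw ν₁ with hFdef
    have hform := ErasureLoop.loss_formula (T := T) (q := q) (Pr := Pr) (V := V) (F := F)
      (vq := ErasureLoop.varQuiet P a ε w) (sc := ErasureLoop.varCross P a ε σw T w)
      (Q := ErasureLoop.Qhat a K Qx Qu ρ p) (c₁ := Qx) (p := p) (σ := σw) (fun i => rfl)
      (fun k hk => by
        rw [← hF (k + 1) hk]
        exact ErasureLoop.quiet_mul_varQuiet hw hwl hneg k)
      (fun i hi => by
        rw [← hD i hi]
        exact ErasureLoop.attempt_mul_varCross hw hwl hneg h2 hm hs hi)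
    rw [hform, ErasureLoop.chainMass_zero]
    have hG : ∑ i ∈ Finset.range (T + 1), (V i + p * ((σw : ℝ) ^ 2
        * (ErasureLoop.seqLaw ν₁).real (ErasureLoop.attemptSet a ε T i)) / (1 - p))
          / (1 - p * a ^ 2)
        = (∑ i ∈ Finset.range (T + 1), (V i + p * ((σw : ℝ) ^ 2 * (q i * Pr i)) / (1 - p)))
          / (1 - p * a ^ 2) := by
      rw [← Finset.sum_div]
      congr 1
      exact Finset.sum_congr rfl fun i hi => by
        rw [hD i (Nat.lt_succ_iff.1 (Finset.mem_range.1 hi))]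
    have hval : Qx * ((1 * ∑ k ∈ Finset.range T, F k + (1 * p + 1 * (1 - p))
          * ∑ i ∈ Finset.range (T + 1), (V i + p * ((σw : ℝ) ^ 2
            * (ErasureLoop.seqLaw ν₁).real (ErasureLoop.attemptSet a ε T i)) / (1 - p))
              / (1 - p * a ^ 2)) / S)
        + ρ * Qu * K ^ 2 * ((0 * ∑ k ∈ Finset.range T, F k + (0 * p + 1 * (1 - p))
          * ∑ i ∈ Finset.range (T + 1), (V i + p * ((σw : ℝ) ^ 2
            * (ErasureLoop.seqLaw ν₁).real (ErasureLoop.attemptSet a ε T i)) / (1 - p))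
              / (1 - p * a ^ 2)) / S)
        = (Qx * ∑ k ∈ Finset.range T, F k + ErasureLoop.Qhat a K Qx Qu ρ p
          * ∑ i ∈ Finset.range (T + 1), (V i + p * ((σw : ℝ) ^ 2 * (q i * Pr i)) / (1 - p)))
            * (1 / S) := by
      -- The two costs combine to the numerator `Qx + (1 - p) * ρ * Qu * K ^ 2` of `Qhat`.
      rw [hG, ErasureLoop.Qhat]
      generalize ∑ i ∈ Finset.range (T + 1), (V i + p * ((σw : ℝ) ^ 2 * (q i * Pr i)) / (1 - p)) = G
      field_simp
      ring
    rw [hval] at hlim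
    refine hlim.congr fun N => ?_
    rw [mul_div_assoc', mul_div_assoc', ← add_div, Finset.mul_sum, Finset.mul_sum,
      ← Finset.sum_add_distrib, div_eq_inv_mul, one_div]
    congr 1
    refine Finset.sum_congr rfl fun k _ => ?_
    simp only [ErasureLoop.weightedCost, ErasureLoop.stageCost, ErasureLoop.input]
    split_ifs <;> ring
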